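/- Let $K\ge 1$, let $n$ be an even positive integer and let $\delta\in(0,1)$. Let $p^\star$ be a probability vector on $[K]=\{1,\dots,K\}$ and let $X_1,\dots,X_n$ be independent random variables with $\mathbb P(X_t=i)=p^\star(i)$. For probability vectors $p,q$ put $\mathrm{KL}(p\|q)=\sum_i p(i)\log(p(i)/q(i))$, with $0\log 0=0$ and $\mathrm{KL}(p\|q)=\infty$ if $q(i)=0<p(i)$ for some $i$; $\log$ is the natural logarithm. Write $\{x\}_+=\max\{1,x\}$ and $n_{i,t}=\sum_{s=1}^{t}\mathbf 1[X_s=i]$. Fix $c\in[1,4]$ and set $$\mathcal J=\{i: n_{i,n/2}<32\log(cK/\delta)\},\qquad J=\max\{3,|\mathcal J|\},$$ $$\tilde{\mathcal J}=\{i: n\,p^\star(i)<32\log(K/\delta)\},\qquad \tilde J=\max\{3,|\tilde{\mathcal J}|\},$$ $$\gamma_i=\max\Big\{1,\frac{\log(K/\delta)}{J}\Big\}\ \text{ if } i\in\mathcal J,\qquad \gamma_i=0\ \text{ otherwise},$$ $$p_{t}(i)=\frac{n_{i,t-1}+\gamma_i}{t-1+\sum_{j=1}^K\gamma_j},\qquad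 p^{\mathrm{OTB}}=\frac2n\sum_{t=n/2+1}^n p_t .$$ There is a universal constant $C>0$ (not depending on $K,n,\delta,c,p^\star$) such that, whenever $\log(K/\delta)\le n$ and $K\le n$, each of the following three inequalities holds with probability at least $1-5\delta$: (i) $\displaystyle \mathrm{KL}(p^\star\|p^{\mathrm{OTB}})\le\frac1n\Big(128K+200\log(800J)\log(1/\delta)+8\tilde J\log\Big(24\Big\{\log\Big(\frac{\tilde J}{\log(1/\delta)}\Big)\Big\}_+\Big)\Big)$; (ii) $\displaystyle \mathrm{KL}(p^\star\|p^{\mathrm{OTB}})\le C\,\frac{K+\tilde J\log\log\tilde J+\log(J)\log(1/\delta)}{n}$; (iii) (worst case) $\displaystyle \mathrm{KL}(p^\star\|p^{\mathrm{OTB}})\le C\,\frac{\bar K\log\log\bar K+\log(\bar K)\log(1/\delta)}{n}$ with $\bar K=\max\{3,K\}$. -/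

import Mathlib

open MeasureTheory ProbabilityTheory

namespace OTB

noncomputable section

/-- The Kullback-Leibler divergence `∑ i, p i * log (p i / q i)` of two vectors on a finite set,
with `0 * log 0 = 0`, and equal to `⊤` if `q i = 0` for some `i` with `p i ≠ 0`. -/
def kl {K : ℕ} (p q : Fin K → ℝ) : EReal :=
  open Classical in
  if ∃ i, p i ≠ 0 ∧ q i = 0 then ⊤
  else ((∑ i, p i * Real.log (p i / q i) : ℝ) : EReal)

variable {K n : ℕ}

/-- `n_{i,t}`: the number of occurrences of the category `i` among the first `t` observations.
The `n` observations are indexed by `0, …, n - 1`. -/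
def count (x : Fin n → Fin K) (t : ℕ) (i : Fin K) : ℕ :=
  (Finset.univ.filter fun s : Fin n => (s : ℕ) < t ∧ x s = i).card

/-- The set of categories that are rarely observed in the first half of the sample,
`{i : n_{i,n/2} < 32 log (c K / δ)}`. -/
def rare (c δ : ℝ) (x : Fin n → Fin K) : Finset (Fin K) :=
  open Classical in
  Finset.univ.filter fun i => (count x (n / 2) i : ℝ) < 32 * Real.log (c * K / δ)

/-- `J`, the number of rarely observed categories, but at least `3`. -/
def J (c δ : ℝ) (x : Fin n → Fin K) : ℕ := max 3 (rare c δ x).card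

/-- `J̃`, the number of categories with `n p(i) < 32 log (K / δ)`, but at least `3`. -/
def Jtilde (n : ℕ) (δ : ℝ) (p : Fin K → ℝ) : ℕ :=
  open Classical in
  max 3 (Finset.univ.filter fun i : Fin K => (n : ℝ) * p i < 32 * Real.log (K / δ)).card

/-- The data-dependent bias `γ_i`. -/
def gam (c δ : ℝ) (x : Fin n → Fin K) (i : Fin K) : ℝ :=
  open Classical in
  if i ∈ rare c δ x then max 1 (Real.log (K / δ) / J c δ x) else 0

/-- The add-`γ_i` estimator `p_t(i) = (n_{i,t-1} + γ_i) / (t - 1 + ∑ j, γ_j)`, for `t ≥ 1`. -/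
def addGam (c δ : ℝ) (x : Fin n → Fin K) (t : ℕ) (i : Fin K) : ℝ :=
  ((count x (t - 1) i : ℝ) + gam c δ x i) / ((t : ℝ) - 1 + ∑ j, gam c δ x j)

/-- The online-to-batch estimator with suffix averaging, `(2 / n) ∑_{t = n/2 + 1}^n p_t`. -/
def pOTB (c δ : ℝ) (x : Fin n → Fin K) (i : Fin K) : ℝ :=
  2 / (n : ℝ) * ∑ t ∈ Finset.Icc (n / 2 + 1) n, addGam c δ x t i

end

end OTB

/-! Write `m = n/2`, `b = s p_i`, `N = count x s i`. Jensen's inequality for `log` bounds the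
divergence of the averaged estimator by the average over `s ∈ [m, 2m)` of the divergences of the
add-`γ` estimators, and each of these is at most `1/s` times the sum over `i` of `relEnt b (N +
γ_i)` (`kl_pOTB_le`).

The reversed quantity `relEnt N b` is the Poisson Chernoff exponent, so half of it has a bounded
exponential moment. Swapping the arguments costs a factor `1 + log (b / (N + γ_i))` and an additive
`γ_i` (`relEnt_add_le`). The logarithm is at most `log 4` for heavy categories. For light ones it is
at most `log T` with `T = 24 * logFactor`, unless `N` falls below `b / T`; it is then still at most
`log (32 J)`, and such misses are so improbable that their total cost is of order `log (1/δ)`. This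
yields `log log J̃` in place of `log J̃`.

Multinomial counts are compared with independent Poisson variables through generating functions
(`sum_weight_mul_prod_le`), without loss of a constant. Convexity of `exp` handles the average over
time, so no union bound over `s` is needed (`prob_sum_gt_le`). -/

namespace OTB

/-! ### Inequalities for the unnormalised relative entropy -/

/-- The unnormalised relative entropy `a log (a / b) - a + b`. -/
noncomputable def relEnt (a b : ℝ) : ℝ := a * Real.log (a / b) - a + b

lemma relEnt_nonneg {a b : ℝ} (ha : 0 ≤ a) (hb : 0 < b) : 0 ≤ relEnt a b := by
  unfold relEnt
  rcases ha.eq_or_lt with rfl | ha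
  · simp [hb.le]
  · have h := Real.one_sub_inv_le_log_of_pos (div_pos ha hb)
    have h2 : a * (1 - (a / b)⁻¹) = a - b := by field_simp
    have h3 := mul_le_mul_of_nonneg_left h ha.le
    linarith

/-- The three-point identity of the Bregman divergence generated by `t log t - t`. -/
lemma relEnt_three_point {a y b : ℝ} (ha : 0 ≤ a) (hy : 0 < y) (hb : 0 < b) :
    relEnt a b = relEnt y b + Real.log (y / b) * (a - y) + relEnt a y := by
  unfold relEnt
  rcases ha.eq_or_lt with rfl | ha
  · simp; ring
  · rw [Real.log_div ha.ne' hb.ne', Real.log_div hy.ne' hb.ne', Real.log_div ha.ne' hy.ne']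
    ring

lemma relEnt_le_relEnt_of_le {a y b : ℝ} (ha : 0 ≤ a) (hay : a ≤ y) (hyb : y ≤ b) (hy : 0 < y) :
    relEnt y b ≤ relEnt a b := by
  have hb : 0 < b := hy.trans_le hyb
  rw [relEnt_three_point ha hy hb]
  have h1 : Real.log (y / b) ≤ 0 :=
    Real.log_nonpos (by positivity) ((div_le_one hb).2 hyb)
  nlinarith [relEnt_nonneg ha hy, mul_nonneg_of_nonpos_of_nonpos h1 (sub_nonpos.2 hay)]

/-- With `u = log (b / y)` the claim is equivalent to `1 + u + u²/2 ≤ exp u`. -/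
lemma relEnt_comm_le_of_lt {y b : ℝ} (hy : 0 < y) (hyb : y < b) :
    relEnt b y ≤ (1 + Real.log (b / y)) * relEnt y b := by
  have hb : 0 < b := hy.trans hyb
  have hu : 0 ≤ Real.log (b / y) := Real.log_nonneg ((one_le_div hy).2 hyb.le)
  have hq := Real.quadratic_le_exp_of_nonneg hu
  rw [Real.exp_log (div_pos hb hy)] at hq
  have hyu : Real.log (y / b) = - Real.log (b / y) := by
    rw [← Real.log_inv, inv_div]
  unfold relEnt
  rw [hyu]
  set u := Real.log (b / y)
  have h2 := mul_le_mul_of_nonneg_left hq hy.le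
  have h3 : y * (b / y) = b := by field_simp
  nlinarith

/-- Equivalent to `2 (y - b) / (y + b) ≤ log (y / b)`. -/
lemma relEnt_comm_le_of_le {y b : ℝ} (hb : 0 < b) (hby : b ≤ y) :
    relEnt b y ≤ relEnt y b := by
  have hy : 0 < y := hb.trans_le hby
  have hx : 0 ≤ y / b - 1 := sub_nonneg.2 ((one_le_div hb).2 hby)
  have h := Real.le_log_one_add_of_nonneg hx
  have hyu : Real.log (b / y) = - Real.log (y / b) := by
    rw [← Real.log_inv, inv_div]
  unfold relEnt
  rw [hyu]
  have e1 : 2 * (y / b - 1) / (y / b - 1 + 2) = 2 * (y - b) / (y + b) := by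
    have h2 : y / b - 1 + 2 = (y + b) / b := by field_simp; ring
    have : y + b ≠ 0 := by positivity
    rw [h2]
    field_simp
  have e2 : 1 + (y / b - 1) = y / b := by ring
  rw [e1, e2, div_le_iff₀ (by positivity)] at h
  linarith

/-- Adding a bias `g` to the second argument of the reversed relative entropy. -/
lemma relEnt_add_le {b N g c : ℝ} (hb : 0 < b) (hN : 0 ≤ N) (hg : 0 ≤ g) (hNg : 0 < N + g)
    (hc : 0 ≤ c) (hlog : Real.log (b / (N + g)) ≤ c) :
    relEnt b (N + g) ≤ (1 + c) * relEnt N b + g := by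
  have hpos := relEnt_nonneg hN hb
  -- If `N + g < b`, the bias only moves `N` towards `b`, so it can be dropped after the swap.
  -- Otherwise the logarithm is nonpositive and the bias costs at most `g`.
  rcases lt_or_ge (N + g) b with h | h
  · have h1 := relEnt_comm_le_of_lt hNg h
    have h2 := relEnt_le_relEnt_of_le hN (le_add_of_nonneg_right hg) h.le hNg
    have h3 := relEnt_nonneg hNg.le hb
    calc relEnt b (N + g) ≤ (1 + Real.log (b / (N + g))) * relEnt (N + g) b := h1
      _ ≤ (1 + c) * relEnt (N + g) b := by gcongr
      _ ≤ (1 + c) * relEnt N b := by gcongr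
      _ ≤ _ := by linarith
  · have hl : Real.log (b / (N + g)) ≤ 0 :=
      Real.log_nonpos (by positivity) ((div_le_one hNg).2 h)
    rcases le_or_gt b N with h' | h'
    · have h1 := relEnt_comm_le_of_le hb h'
      have hN' : 0 < N := hb.trans_le h'
      have h2 : Real.log (b / (N + g)) ≤ Real.log (b / N) := by
        apply Real.log_le_log (by positivity)
        gcongr
        linarith
      have h3 : relEnt b (N + g) ≤ relEnt b N + g := by
        unfold relEnt
        have := mul_le_mul_of_nonneg_left h2 hb.le
        linarith
      nlinarith
    · have h3 : relEnt b (N + g) ≤ g := by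
        unfold relEnt
        have := mul_nonpos_of_nonneg_of_nonpos hb.le hl
        linarith
      nlinarith

/-! ### Poisson exponential moments by generating functions -/

/-- On `{0, …, s}` the function `f` is bounded by a nonnegative combination of powers `x ^ N`
whose expectation under a Poisson law of mean `μ` is at most `v`. -/
def PoissonDominated (s : ℕ) (μ : ℝ) (f : ℕ → ℝ) (v : ℝ) : Prop :=
  ∃ (ι : Type) (_ : Fintype ι) (a x : ι → ℝ), (∀ k, 0 ≤ a k) ∧ (∀ k, 0 ≤ x k) ∧
    (∀ N ≤ s, f N ≤ ∑ k, a k * x k ^ N) ∧ ∑ k, a k * Real.exp (μ * (x k - 1)) ≤ v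

namespace PoissonDominated

variable {s : ℕ} {μ v w : ℝ} {f g : ℕ → ℝ}

lemma mono (h : PoissonDominated s μ f v) (hg : ∀ N ≤ s, g N ≤ f N) (hv : v ≤ w) :
    PoissonDominated s μ g w := by
  obtain ⟨ι, _, a, x, ha, hx, hf, hs⟩ := h
  exact ⟨ι, ‹_›, a, x, ha, hx, fun N hN => (hg N hN).trans (hf N hN), hs.trans hv⟩

lemma add (hf : PoissonDominated s μ f v) (hg : PoissonDominated s μ g w) :
    PoissonDominated s μ (fun N => f N + g N) (v + w) := by
  obtain ⟨ι, _, a, x, ha, hx, hf, hs⟩ := hf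
  obtain ⟨κ, _, b, y, hb, hy, hg, ht⟩ := hg
  refine ⟨ι ⊕ κ, inferInstance, Sum.elim a b, Sum.elim x y, ?_, ?_, ?_, ?_⟩
  · rintro (k | k) <;> simp [ha, hb]
  · rintro (k | k) <;> simp [hx, hy]
  · intro N hN
    simpa [Fintype.sum_sum_type] using add_le_add (hf N hN) (hg N hN)
  · simpa [Fintype.sum_sum_type] using add_le_add hs ht

lemma const_mul {c : ℝ} (hc : 0 ≤ c) (hf : PoissonDominated s μ f v) :
    PoissonDominated s μ (fun N => c * f N) (c * v) := by
  obtain ⟨ι, _, a, x, ha, hx, hf, hs⟩ := hf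
  refine ⟨ι, ‹_›, fun k => c * a k, x, fun k => mul_nonneg hc (ha k), hx, fun N hN => ?_, ?_⟩
  · simp only [mul_assoc, ← Finset.mul_sum]
    exact mul_le_mul_of_nonneg_left (hf N hN) hc
  · simp only [mul_assoc, ← Finset.mul_sum]
    exact mul_le_mul_of_nonneg_left hs hc

lemma pow {a x : ℝ} (ha : 0 ≤ a) (hx : 0 ≤ x) :
    PoissonDominated s μ (fun N => a * x ^ N) (a * Real.exp (μ * (x - 1))) :=
  ⟨Unit, inferInstance, fun _ => a, fun _ => x, fun _ => ha, fun _ => hx, by simp, by simp⟩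

lemma one : PoissonDominated s μ (fun _ => 1) 1 := by
  simpa using pow (s := s) (μ := μ) (a := 1) (x := 1) zero_le_one zero_le_one

lemma zero : PoissonDominated s μ (fun _ => 0) 0 := by
  simpa using pow (s := s) (μ := μ) (a := 0) (x := 1) le_rfl zero_le_one

lemma sum {α : Type*} (S : Finset α) (F : α → ℕ → ℝ) (V : α → ℝ)
    (h : ∀ k ∈ S, PoissonDominated s μ (F k) (V k)) :
    PoissonDominated s μ (fun N => ∑ k ∈ S, F k N) (∑ k ∈ S, V k) := by
  classical
  induction S using Finset.induction_on with
  | empty => simpa using zero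
  | insert a S ha ih =>
    simp only [Finset.sum_insert ha]
    exact (h a (by simp)).add (ih fun k hk => h k (by simp [hk]))

open Classical in
/-- Chernoff's bound, for a set of values on one side of `N₀` whose extreme point is `N₀`. -/
lemma chernoff (hμ : 0 < μ) (N₀ : ℕ) (S : Set ℕ)
    (hS : (μ ≤ N₀ ∧ ∀ N ∈ S, N₀ ≤ N) ∨ ((N₀ : ℝ) ≤ μ ∧ ∀ N ∈ S, N ≤ N₀)) :
    PoissonDominated s μ (fun N => if N ∈ S then 1 else 0) (Real.exp (- relEnt N₀ μ)) := by
  -- This `x` minimises `x⁻ᴺ⁰ exp (μ (x - 1))`. For `N₀ = 0` it is `0`, and `0 ^ 0 = 1` gives the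
  -- indicator of `{0}`.
  set x : ℝ := N₀ / μ with hx
  have hx0 : 0 ≤ x := by positivity
  have hxN : 0 < x ^ N₀ := by
    rcases Nat.eq_zero_or_pos N₀ with h | h
    · simp [h]
    · have : (0 : ℝ) < N₀ := by exact_mod_cast h
      positivity
  refine (pow (s := s) (μ := μ) (a := (x ^ N₀)⁻¹) (x := x) (by positivity) hx0).mono ?_ ?_
  · intro N _
    split_ifs with hN
    · rw [inv_mul_eq_div, one_le_div hxN]
      rcases hS with ⟨h, hS⟩ | ⟨h, hS⟩
      · exact pow_le_pow_right₀ ((one_le_div hμ).2 h) (hS N hN)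
      · exact pow_le_pow_of_le_one hx0 ((div_le_one hμ).2 h) (hS N hN)
    · positivity
  · have h1 : x ^ N₀ = Real.exp (N₀ * Real.log x) := by
      rcases Nat.eq_zero_or_pos N₀ with h | h
      · simp [h]
      · have : (0 : ℝ) < N₀ := by exact_mod_cast h
        have hx' : 0 < x := by positivity
        rw [mul_comm, Real.exp_mul, Real.exp_log hx', Real.rpow_natCast]
    rw [h1, ← Real.exp_neg, ← Real.exp_add]
    apply le_of_eq
    congr 1
    unfold relEnt
    rw [← hx]
    have : μ * x = N₀ := by rw [hx]; field_simp
    linarith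

-- Each side of the mean is treated separately. A nonempty one-sided set of naturals attains its
-- point nearest to `μ`, and `chernoff` at that point gives `exp (-k)`.
open Classical in
lemma relEnt_ge (hμ : 0 < μ) (k : ℝ) :
    PoissonDominated s μ (fun N => if k ≤ relEnt N μ then 1 else 0) (2 * Real.exp (-k)) := by
  have key : ∀ S : Set ℕ, (∀ N ∈ S, k ≤ relEnt N μ) → ((∀ N ∈ S, μ ≤ N) ∨ ∀ N ∈ S, (N : ℝ) ≤ μ) →
      PoissonDominated s μ (fun N => if N ∈ S then 1 else 0) (Real.exp (-k)) := by
    intro S hk hS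
    rcases S.eq_empty_or_nonempty with rfl | hne
    · simpa using (zero (s := s) (μ := μ)).mono (fun _ _ => le_rfl) (Real.exp_pos (-k)).le
    rcases hS with hS | hS
    · have hm := Nat.sInf_mem hne
      refine (chernoff hμ (sInf S) S (Or.inl ⟨hS _ hm, fun N hN => Nat.sInf_le hN⟩)).mono
        (fun _ _ => le_rfl) ?_
      exact Real.exp_le_exp.2 (neg_le_neg (hk _ hm))
    · have hb : BddAbove S := ⟨⌊μ⌋₊, fun N hN => Nat.le_floor (hS N hN)⟩
      have hm := Nat.sSup_mem hne hb
      refine (chernoff hμ (sSup S) S (Or.inr ⟨hS _ hm, fun N hN => le_csSup hb hN⟩)).mono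
        (fun _ _ => le_rfl) ?_
      exact Real.exp_le_exp.2 (neg_le_neg (hk _ hm))
  have h1 := key {N | k ≤ relEnt N μ ∧ μ ≤ N} (fun N h => h.1) (Or.inl fun N h => h.2)
  have h2 := key {N | k ≤ relEnt N μ ∧ (N : ℝ) ≤ μ} (fun N h => h.1) (Or.inr fun N h => h.2)
  refine (h1.add h2).mono (fun N _ => ?_) (by linarith)
  simp only [Set.mem_ofPred_eq]
  by_cases hk : k ≤ relEnt N μ
  · rcases le_total μ N with h | h
    · simp only [hk, h, and_self, if_true]
      split_ifs <;> norm_num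
    · simp only [hk, h, and_self, if_true]
      split_ifs <;> norm_num
  · simp [hk]

/-- Layer-cake sum: with `y = exp (1/2)`, `exp (r/2) ≤ y (1 + ∑_{k ≥ 1} y^k 1[k ≤ r])`. The tails `2
exp (-k)` make this a geometric series with value `y (y + 1) / (y - 1) ≤ exp 2`. -/
lemma exp_half_relEnt (hμ : 0 ≤ μ) :
    PoissonDominated s μ (fun N => Real.exp (1 / 2 * relEnt N μ)) (Real.exp 2) := by
  classical
  rcases hμ.eq_or_lt with rfl | hμ
  -- Division by zero makes `relEnt N 0 = -N`.
  · refine one.mono (fun N _ => ?_) (Real.one_le_exp (by norm_num))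
    rw [Real.exp_le_one_iff]
    simp [relEnt]
  set y := Real.exp (1 / 2) with hy
  -- A crude cutoff: only `N ≤ s` matters, so finitely many layers suffice.
  set R : ℕ := ⌊∑ N ∈ Finset.range (s + 1), relEnt N μ⌋₊ with hR
  have h := ((one (s := s) (μ := μ)).add (sum (Finset.range R)
    (fun k N => y ^ (k + 1) * (if ((k + 1 : ℕ) : ℝ) ≤ relEnt N μ then 1 else 0)) _
    (fun k _ => const_mul (by positivity) (relEnt_ge hμ ((k + 1 : ℕ) : ℝ))))).const_mul
      (c := y) (Real.exp_pos _).le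
  refine h.mono (fun N hN => ?_) ?_
  · have h0 := relEnt_nonneg (Nat.cast_nonneg N) hμ
    have hfl := Nat.lt_floor_add_one (relEnt N μ)
    have hle : ⌊relEnt N μ⌋₊ ≤ R := by
      apply Nat.floor_le_floor
      exact Finset.single_le_sum (f := fun N : ℕ => relEnt N μ)
        (fun i _ => relEnt_nonneg (Nat.cast_nonneg i) hμ) (by simp; omega)
    have hfl' := Nat.floor_le h0
    have e1 : Real.exp (1 / 2 * relEnt N μ) ≤ y * y ^ ⌊relEnt N μ⌋₊ := by
      rw [hy, ← pow_succ', ← Real.exp_nat_mul]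
      apply Real.exp_le_exp.2
      push_cast
      linarith
    refine e1.trans (mul_le_mul_of_nonneg_left ?_ (Real.exp_pos _).le)
    have hnn : ∀ k ∈ Finset.range R, (0 : ℝ) ≤
        y ^ (k + 1) * (if ((k + 1 : ℕ) : ℝ) ≤ relEnt N μ then 1 else 0) := by
      intro k _
      have : 0 < y := Real.exp_pos _
      split_ifs <;> positivity
    rcases Nat.eq_zero_or_pos ⌊relEnt N μ⌋₊ with hz | hz
    · rw [hz, pow_zero]
      linarith [Finset.sum_nonneg hnn]
    · obtain ⟨k, hk⟩ := Nat.exists_eq_succ_of_ne_zero hz.ne'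
      have := Finset.single_le_sum hnn (a := k) (by simp; omega)
      rw [hk] at hfl' ⊢
      rw [if_pos hfl', mul_one] at this
      simp only [Nat.succ_eq_add_one]
      linarith
  · have hy0 : 0 < y := Real.exp_pos _
    have hyy : y * y = Real.exp 1 := by rw [hy, ← Real.exp_add]; norm_num
    have he1 := Real.exp_one_gt_d9
    have he2 := Real.exp_one_lt_d9
    have hyl : 1.648 < y := by nlinarith
    have hyu : y < 1.65 := by nlinarith
    have e1 : ∀ k ∈ Finset.range R, y ^ (k + 1) * (2 * Real.exp (-((k + 1 : ℕ) : ℝ)))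
        = 2 * y⁻¹ * (y⁻¹) ^ k := by
      intro k _
      have : Real.exp (-((k + 1 : ℕ) : ℝ)) = (y⁻¹) ^ (k + 1) * (y⁻¹) ^ (k + 1) := by
        rw [← mul_pow, ← mul_inv, hyy, ← Real.exp_neg, ← Real.exp_nat_mul]
        congr 1
        ring
      rw [this, inv_pow, inv_pow, pow_succ]
      field_simp
    rw [Finset.sum_congr rfl e1, ← Finset.mul_sum]
    have hlt : y⁻¹ < 1 := inv_lt_one_of_one_lt₀ (by linarith)
    have e2 : ∑ k ∈ Finset.range R, (y⁻¹) ^ k ≤ (1 - y⁻¹)⁻¹ := by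
      rw [← tsum_geometric_of_lt_one (by positivity) hlt]
      exact Summable.sum_le_tsum _ (fun _ _ => by positivity)
        (summable_geometric_of_lt_one (by positivity) hlt)
    have e3 : 2 * y⁻¹ * (1 - y⁻¹)⁻¹ = 2 / (y - 1) := by
      have : y - 1 ≠ 0 := by linarith
      have : 1 - y⁻¹ ≠ 0 := by linarith
      field_simp
    have e4 : y * (1 + 2 * y⁻¹ * ∑ k ∈ Finset.range R, (y⁻¹) ^ k) ≤ y * (1 + 2 / (y - 1)) := by
      rw [← e3]
      gcongr
    refine e4.trans ?_
    have e5 : Real.exp 2 = (y * y) * (y * y) := by rw [hyy, ← Real.exp_add]; norm_num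
    have e6 : y * (1 + 2 / (y - 1)) = y * (y + 1) / (y - 1) := by
      have : y - 1 ≠ 0 := by linarith
      field_simp
      ring
    rw [e5, e6, div_le_iff₀ (by linarith)]
    rw [← hyy] at he1 he2
    have : y + 1 ≤ (y * y) * (y * (y - 1)) := by nlinarith
    nlinarith

end PoissonDominated

/-! ### The finite product model and comparison with Poisson variables -/

open Classical in
/-- The probability of `A` under `n` independent draws from `p`. -/
noncomputable def prob {K n : ℕ} (p : Fin K → ℝ) (A : (Fin n → Fin K) → Prop) : ℝ :=
  ∑ x, (∏ t, p (x t)) * (if A x then 1 else 0)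

section

variable {K n : ℕ} {p : Fin K → ℝ}

lemma weight_nonneg (hp : p ∈ stdSimplex ℝ (Fin K)) (x : Fin n → Fin K) : 0 ≤ ∏ t, p (x t) :=
  Finset.prod_nonneg fun t _ => hp.1 (x t)

lemma prob_le_sum (hp : p ∈ stdSimplex ℝ (Fin K)) {A : (Fin n → Fin K) → Prop}
    {G : (Fin n → Fin K) → ℝ} (hG : ∀ x, 0 ≤ G x) (hA : ∀ x, A x → 1 ≤ G x) :
    prob p A ≤ ∑ x, (∏ t, p (x t)) * G x := by
  classical
  unfold prob
  refine Finset.sum_le_sum fun x _ => mul_le_mul_of_nonneg_left ?_ (weight_nonneg hp x)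
  split_ifs with h
  · exact hA x h
  · exact hG x

lemma prob_or_le (hp : p ∈ stdSimplex ℝ (Fin K)) (A B : (Fin n → Fin K) → Prop) :
    prob p (fun x => A x ∨ B x) ≤ prob p A + prob p B := by
  classical
  unfold prob
  rw [← Finset.sum_add_distrib]
  refine Finset.sum_le_sum fun x _ => ?_
  rw [← mul_add]
  refine mul_le_mul_of_nonneg_left ?_ (weight_nonneg hp x)
  by_cases hA : A x <;> by_cases hB : B x <;> simp [hA, hB]

lemma prob_exists_le (hp : p ∈ stdSimplex ℝ (Fin K)) {ι : Type*} (S : Finset ι)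
    (A : ι → (Fin n → Fin K) → Prop) :
    prob p (fun x => ∃ i ∈ S, A i x) ≤ ∑ i ∈ S, prob p (A i) := by
  classical
  unfold prob
  rw [Finset.sum_comm]
  refine Finset.sum_le_sum fun x _ => ?_
  rw [← Finset.mul_sum]
  refine mul_le_mul_of_nonneg_left ?_ (weight_nonneg hp x)
  have hnn : ∀ i ∈ S, (0 : ℝ) ≤ if A i x then 1 else 0 := fun i _ => by split_ifs <;> norm_num
  split_ifs with h
  · obtain ⟨i, hi, hA⟩ := h
    have := Finset.single_le_sum hnn hi
    rwa [if_pos hA] at this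
  · exact Finset.sum_nonneg hnn

lemma prod_pow_count (y : Fin K → ℝ) (s : ℕ) (x : Fin n → Fin K) :
    ∏ i, y i ^ count x s i = ∏ t : Fin n, if (t : ℕ) < s then y (x t) else 1 := by
  classical
  rw [← Finset.prod_filter, ← Finset.prod_fiberwise' _ x y]
  refine Finset.prod_congr rfl fun i _ => ?_
  rw [Finset.prod_const, Finset.filter_filter, count]

/-- The probability generating function of the counts. -/
lemma sum_weight_mul_prod_pow (hp : p ∈ stdSimplex ℝ (Fin K)) (y : Fin K → ℝ) {s : ℕ}
    (hs : s ≤ n) :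
    ∑ x : Fin n → Fin K, (∏ t, p (x t)) * ∏ i, y i ^ count x s i = (∑ i, p i * y i) ^ s := by
  classical
  simp only [prod_pow_count, ← Finset.prod_mul_distrib]
  have h := Finset.prod_univ_sum (fun _ : Fin n => (Finset.univ : Finset (Fin K)))
    (fun t i => p i * if (t : ℕ) < s then y i else 1)
  rw [Fintype.piFinset_univ] at h
  rw [← h]
  have h2 : ∀ t : Fin n, ∑ i, p i * (if (t : ℕ) < s then y i else 1)
      = if (t : ℕ) < s then ∑ i, p i * y i else 1 := by
    intro t
    split_ifs
    · rfl
    · simpa using hp.2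
  simp only [h2]
  rw [← Finset.prod_filter, Finset.prod_const]
  congr 1
  rw [Fin.card_filter_val_lt, min_eq_right hs]

/-- The generating function is the `s`-th power of `1 + u` with `u = ∑ p_i (y_i - 1)`, and `1 + u ≤
exp u`. -/
lemma sum_weight_mul_prod_pow_le (hp : p ∈ stdSimplex ℝ (Fin K)) {y : Fin K → ℝ}
    (hy : ∀ i, 0 ≤ y i) {s : ℕ} (hs : s ≤ n) :
    ∑ x : Fin n → Fin K, (∏ t, p (x t)) * ∏ i, y i ^ count x s i
      ≤ ∏ i, Real.exp (s * p i * (y i - 1)) := by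
  rw [sum_weight_mul_prod_pow hp y hs, ← Real.exp_sum]
  have h1 : ∑ i, (s : ℝ) * p i * (y i - 1) = s * (∑ i, p i * y i - 1) := by
    simp only [mul_assoc, ← Finset.mul_sum, mul_sub, mul_one, Finset.sum_sub_distrib, hp.2]
  rw [h1, Real.exp_nat_mul]
  have h0 : 0 ≤ ∑ i, p i * y i := Finset.sum_nonneg fun i _ => mul_nonneg (hp.1 i) (hy i)
  refine pow_le_pow_left₀ h0 ?_ s
  linarith [Real.add_one_le_exp (∑ i, p i * y i - 1)]

lemma count_le (x : Fin n → Fin K) (s : ℕ) (i : Fin K) : count x s i ≤ s := by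
  unfold count
  calc _ ≤ ((Finset.univ.filter fun t : Fin n => (t : ℕ) < s ∧ x t = i).image
        (fun t : Fin n => (t : ℕ))).card := by
        rw [Finset.card_image_of_injective _ Fin.val_injective]
    _ ≤ (Finset.range s).card := Finset.card_le_card fun a ha => by
        simp only [Finset.mem_image, Finset.mem_filter, Finset.mem_univ, true_and] at ha
        obtain ⟨t, ht, rfl⟩ := ha
        simpa using ht.1
    _ = s := Finset.card_range s

/-- Comparison of multinomial counts with independent Poisson variables. -/
lemma sum_weight_mul_prod_le (hp : p ∈ stdSimplex ℝ (Fin K)) {s : ℕ} (hs : s ≤ n)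
    {f : Fin K → ℕ → ℝ} {v : Fin K → ℝ} (hf : ∀ i N, 0 ≤ f i N)
    (h : ∀ i, PoissonDominated s (s * p i) (f i) (v i)) :
    ∑ x : Fin n → Fin K, (∏ t, p (x t)) * ∏ i, f i (count x s i) ≤ ∏ i, v i := by
  classical
  choose ι hι a y ha hy hfa hv using h
  -- Expanding the product of sums leaves nonnegative multiples of `∏ y_i ^ N_i`, to which the
  -- generating function applies term by term.
  have e : ∀ x : Fin n → Fin K, ∏ i, f i (count x s i) ≤
      ∑ k : (∀ i, ι i), (∏ i, a i (k i)) * ∏ i, y i (k i) ^ count x s i := by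
    intro x
    calc ∏ i, f i (count x s i) ≤ ∏ i, ∑ k, a i k * y i k ^ count x s i :=
          Finset.prod_le_prod (fun i _ => hf i _) fun i _ => hfa i _ (count_le x s i)
      _ = _ := by
        rw [Finset.prod_univ_sum, Fintype.piFinset_univ]
        simp only [Finset.prod_mul_distrib]
  calc _ ≤ ∑ x : Fin n → Fin K, (∏ t, p (x t)) *
        ∑ k : (∀ i, ι i), (∏ i, a i (k i)) * ∏ i, y i (k i) ^ count x s i :=
        Finset.sum_le_sum fun x _ => mul_le_mul_of_nonneg_left (e x) (weight_nonneg hp x)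
    _ = ∑ k : (∀ i, ι i), (∏ i, a i (k i)) *
        ∑ x : Fin n → Fin K, (∏ t, p (x t)) * ∏ i, y i (k i) ^ count x s i := by
        simp only [Finset.mul_sum]
        rw [Finset.sum_comm]
        refine Finset.sum_congr rfl fun k _ => Finset.sum_congr rfl fun x _ => by ring
    _ ≤ ∑ k : (∀ i, ι i), (∏ i, a i (k i)) * ∏ i, Real.exp (s * p i * (y i (k i) - 1)) := by
        refine Finset.sum_le_sum fun k _ => mul_le_mul_of_nonneg_left ?_
          (Finset.prod_nonneg fun i _ => ha i _)
        exact sum_weight_mul_prod_pow_le hp (fun i => hy i _) hs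
    _ = ∏ i, ∑ k, a i k * Real.exp (s * p i * (y i k - 1)) := by
        rw [Finset.prod_univ_sum, Fintype.piFinset_univ]
        simp only [Finset.prod_mul_distrib]
    _ ≤ ∏ i, v i := Finset.prod_le_prod
        (fun i _ => Finset.sum_nonneg fun k _ => mul_nonneg (ha i k) (Real.exp_pos _).le)
        fun i _ => hv i

/-- A Chernoff bound for one count: every other category receives the factor `1`. -/
lemma prob_count_le (hp : p ∈ stdSimplex ℝ (Fin K)) {s : ℕ} (hs : s ≤ n) (i : Fin K)
    {B : ℕ → Prop} {a x w : ℝ} (ha : 0 ≤ a) (hx : 0 ≤ x) (hB : ∀ N, B N → 1 ≤ a * x ^ N)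
    (hw : a * Real.exp (s * p i * (x - 1)) ≤ w) :
    prob p (fun z : Fin n → Fin K => B (count z s i)) ≤ w := by
  classical
  have h := sum_weight_mul_prod_le (n := n) hp hs
    (f := fun j N => if j = i then a * x ^ N else 1) (v := fun j => if j = i then w else 1)
    (fun j N => by split_ifs <;> positivity)
    (fun j => by
      by_cases hj : j = i
      · subst hj
        simpa using (PoissonDominated.pow ha hx).mono (fun _ _ => le_rfl) hw
      · simpa [hj] using PoissonDominated.one)
  simp only [Finset.prod_ite_eq', Finset.mem_univ, if_true] at h
  exact (prob_le_sum hp (fun z => by positivity) fun z hz => hB _ hz).trans h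

/-- A tail bound for averages over time of sums of functions of the counts. -/
lemma prob_sum_gt_le (hp : p ∈ stdSimplex ℝ (Fin K)) {m : ℕ} (hm : 0 < m) (hmn : 2 * m ≤ n)
    {F : ℕ → Fin K → ℕ → ℝ} {v : Fin K → ℝ}
    (h : ∀ s ∈ Finset.Ico m (2 * m), ∀ i,
      PoissonDominated s (s * p i) (fun N => Real.exp (1 / 2 * F s i N)) (Real.exp (v i)))
    {δ : ℝ} (hδ : 0 < δ) :
    prob p (fun x : Fin n → Fin K => (m : ℝ) * (2 * ∑ i, v i + 2 * Real.log (1 / δ))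
      < ∑ s ∈ Finset.Ico m (2 * m), ∑ i, F s i (count x s i)) ≤ δ := by
  classical
  have hm' : (0 : ℝ) < m := by exact_mod_cast hm
  set V := ∑ i, v i with hV
  have hbase : ∀ s ∈ Finset.Ico m (2 * m),
      ∑ x : Fin n → Fin K, (∏ t, p (x t)) * Real.exp (1 / 2 * ∑ i, F s i (count x s i))
        ≤ Real.exp V := by
    intro s hs
    have hsn : s ≤ n := by
      have := (Finset.mem_Ico.1 hs).2
      omega
    have := sum_weight_mul_prod_le (n := n) hp hsn (fun _ _ => (Real.exp_pos _).le) (h s hs)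
    simpa only [← Real.exp_sum, ← Finset.mul_sum, ← hV] using this
  -- Markov's inequality for the time average of exponentials, which by convexity dominates the
  -- exponential of the time average. Dependence between times is therefore harmless.
  have hG := prob_le_sum (n := n) hp (A := fun x : Fin n → Fin K =>
      (m : ℝ) * (2 * V + 2 * Real.log (1 / δ))
        < ∑ s ∈ Finset.Ico m (2 * m), ∑ i, F s i (count x s i))
    (G := fun x => (δ * Real.exp (-V)) *
      ∑ s ∈ Finset.Ico m (2 * m), (1 / (m : ℝ)) * Real.exp (1 / 2 * ∑ i, F s i (count x s i)))
    (fun x => by positivity) (fun x hx => by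
      have hconv := convexOn_exp.map_sum_le (t := Finset.Ico m (2 * m))
        (w := fun _ => 1 / (m : ℝ)) (p := fun s => 1 / 2 * ∑ i, F s i (count x s i))
        (fun _ _ => by positivity)
        (by
          simp only [Finset.sum_const, Nat.card_Ico, nsmul_eq_mul]
          rw [show 2 * m - m = m by omega]
          field_simp)
        (fun _ _ => Set.mem_univ _)
      simp only [smul_eq_mul, ← Finset.mul_sum] at hconv ⊢
      refine le_trans ?_ (mul_le_mul_of_nonneg_left hconv (by positivity))
      have e1 : δ = Real.exp (- Real.log (1 / δ)) := by
        rw [one_div, Real.log_inv, neg_neg, Real.exp_log hδ]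
      rw [e1, ← Real.exp_add, ← Real.exp_add]
      apply Real.one_le_exp
      have : 2 * V + 2 * Real.log (1 / δ) ≤
          1 / (m : ℝ) * ∑ s ∈ Finset.Ico m (2 * m), ∑ i, F s i (count x s i) := by
        rw [one_div_mul_eq_div, le_div_iff₀ hm', mul_comm]
        exact hx.le
      linarith)
  refine hG.trans ?_
  have e2 : ∑ x : Fin n → Fin K, (∏ t, p (x t)) * ((δ * Real.exp (-V)) *
      ∑ s ∈ Finset.Ico m (2 * m), (1 / (m : ℝ)) * Real.exp (1 / 2 * ∑ i, F s i (count x s i)))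
      = (δ * Real.exp (-V)) * ∑ s ∈ Finset.Ico m (2 * m), (1 / (m : ℝ)) *
        ∑ x : Fin n → Fin K, (∏ t, p (x t)) * Real.exp (1 / 2 * ∑ i, F s i (count x s i)) := by
    simp only [Finset.mul_sum]
    rw [Finset.sum_comm]
    refine Finset.sum_congr rfl fun s _ => Finset.sum_congr rfl fun x _ => by
      simp only [← Finset.mul_sum]; ring
  rw [e2]
  calc _ ≤ (δ * Real.exp (-V)) * ∑ s ∈ Finset.Ico m (2 * m), (1 / (m : ℝ)) * Real.exp V := by
        refine mul_le_mul_of_nonneg_left (Finset.sum_le_sum fun s hs => ?_) (by positivity)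
        exact mul_le_mul_of_nonneg_left (hbase s hs) (by positivity)
    _ = δ := by
        simp only [Finset.sum_const, Nat.card_Ico, nsmul_eq_mul]
        rw [show 2 * m - m = m by omega, Real.exp_neg]
        field_simp

/-- Events of high probability in the finite model have high probability for the sample. -/
lemma one_sub_le_measureReal {Ω : Type*} [MeasurableSpace Ω] (P : Measure Ω)
    [IsProbabilityMeasure P] {X : Fin n → Ω → Fin K} (hind : iIndepFun X P)
    (hX : ∀ t i, P.real {ω | X t ω = i} = p i) {A B : (Fin n → Fin K) → Prop}
    (hAB : ∀ x, ¬ B x → (∀ t, p (x t) ≠ 0) → A x) :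
    1 - prob p B ≤ P.real {ω | A fun t => X t ω} := by
  classical
  have hpt : ∀ x : Fin n → Fin K, P.real {ω | (fun t => X t ω) = x} = ∏ t, p (x t) := by
    intro x
    have h := iIndepFun_iff_measure_inter_preimage_eq_mul.1 hind Finset.univ
      (sets := fun t => {x t}) (fun t _ => MeasurableSet.singleton _)
    have e : {ω | (fun t => X t ω) = x} = ⋂ t ∈ (Finset.univ : Finset (Fin n)), X t ⁻¹' {x t} := by
      ext ω
      simp [funext_iff]
    rw [Measure.real, e, h, ENNReal.toReal_prod]
    refine Finset.prod_congr rfl fun t _ => ?_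
    rw [← hX t (x t)]
    rfl
  have h1 : (1 : ℝ) ≤ P.real {ω | A fun t => X t ω} + P.real {ω | ¬ A fun t => X t ω} := by
    have := measureReal_union_le (μ := P) {ω | A fun t => X t ω} {ω | ¬ A fun t => X t ω}
    have e : {ω | A fun t => X t ω} ∪ {ω | ¬ A fun t => X t ω} = Set.univ := by
      ext ω
      simp [em]
    rw [e, probReal_univ] at this
    exact this
  have h2 : P.real {ω | ¬ A fun t => X t ω} ≤ prob p B := by
    have e : {ω | ¬ A fun t => X t ω} =
        ⋃ x ∈ (Finset.univ.filter fun x : Fin n → Fin K => ¬ A x), {ω | (fun t => X t ω) = x} := by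
      ext ω
      simp
    rw [e]
    refine (measureReal_biUnion_finset_le _ _).trans ?_
    simp only [hpt]
    rw [Finset.sum_filter]
    unfold prob
    refine Finset.sum_le_sum fun x _ => ?_
    have hw : 0 ≤ ∏ t, p (x t) := by rw [← hpt]; exact measureReal_nonneg
    by_cases hA : A x
    · simp only [hA, not_true_eq_false, if_false]
      split_ifs <;> simp [hw]
    · by_cases hB : B x
      · simp [hA, hB]
      -- A sample containing a category of probability zero has weight zero.
      · have : ∃ t, p (x t) = 0 := by
          by_contra hcon
          exact hA (hAB x hB fun t ht => hcon ⟨t, ht⟩)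
        obtain ⟨t, ht⟩ := this
        have h0 : ∏ t, p (x t) = 0 := Finset.prod_eq_zero (Finset.mem_univ t) ht
        simp [h0]
  linarith

/-! ### Reduction of the divergence to unnormalised relative entropies -/

variable {c δ : ℝ}

lemma gam_nonneg (c δ : ℝ) (x : Fin n → Fin K) (i : Fin K) : 0 ≤ gam c δ x i := by
  classical
  unfold gam
  split_ifs
  · exact zero_le_one.trans (le_max_left _ _)
  · exact le_rfl

lemma pOTB_eq {m : ℕ} (hn : n = 2 * m) (c δ : ℝ) (x : Fin n → Fin K) (i : Fin K) :
    pOTB c δ x i = ∑ s ∈ Finset.Ico m (2 * m), (1 / (m : ℝ)) *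
      (((count x s i : ℝ) + gam c δ x i) / ((s : ℝ) + ∑ j, gam c δ x j)) := by
  have e1 : n / 2 = m := by omega
  have e2 : Finset.Icc (n / 2 + 1) n = Finset.Ico (m + 1) (2 * m + 1) := by
    ext t
    simp only [Finset.mem_Icc, Finset.mem_Ico]
    omega
  unfold pOTB
  rw [e2, ← Finset.sum_Ico_add', ← Finset.mul_sum]
  congr 1
  · rw [hn]
    push_cast
    rw [div_mul_eq_div_div, div_self (two_ne_zero)]
  · refine Finset.sum_congr rfl fun s _ => ?_
    unfold addGam
    simp

/-- The relative entropy of a normalised estimator is at most that of the unnormalised one. -/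
lemma sum_mul_log_div_le (hp : p ∈ stdSimplex ℝ (Fin K)) {s : ℝ} (hs : 0 < s) {N : Fin K → ℝ}
    {g : Fin K → ℝ} (hN : ∑ i, N i = s) (hg : ∀ i, 0 ≤ g i) (hpos : ∀ i, 0 < N i + g i) :
    ∑ i, p i * Real.log (p i / ((N i + g i) / (s + ∑ j, g j))) ≤
      1 / s * ∑ i, relEnt (s * p i) (N i + g i) := by
  set G := ∑ j, g j with hG
  have hG0 : 0 ≤ G := Finset.sum_nonneg fun i _ => hg i
  -- Summed over `i`, the terms `s p_i` and `N_i` cancel because both total `s`; the remaining `-G /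
  -- s` absorbs `log ((s + G) / s) ≤ G / s`.
  have e : ∀ i, p i * Real.log (p i / ((N i + g i) / (s + G))) =
      1 / s * (relEnt (s * p i) (N i + g i) + s * p i - N i - g i)
        + p i * Real.log ((s + G) / s) := by
    intro i
    rcases (hp.1 i).eq_or_lt with h | h
    · simp [← h, relEnt]
    · have h1 := hpos i
      have h2 : 0 < s + G := by positivity
      unfold relEnt
      rw [Real.log_div h.ne' (by positivity), Real.log_div h1.ne' h2.ne',
        Real.log_div (by positivity) h1.ne', Real.log_div h2.ne' hs.ne',
        Real.log_mul hs.ne' h.ne']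
      field_simp
      ring
  simp only [e, Finset.sum_add_distrib, ← Finset.mul_sum, ← Finset.sum_mul,
    Finset.sum_sub_distrib, hp.2, hN, ← hG]
  have h3 := Real.log_le_sub_one_of_pos (show 0 < (s + G) / s by positivity)
  have h4 : (s + G) / s - 1 = 1 / s * G := by field_simp; ring
  rw [h4] at h3
  linarith

lemma sum_count (x : Fin n → Fin K) {s : ℕ} (hs : s ≤ n) : ∑ i, (count x s i : ℝ) = s := by
  classical
  have h : ∑ i, count x s i = (Finset.univ.filter fun t : Fin n => (t : ℕ) < s).card := by
    rw [Finset.card_eq_sum_card_fiberwise (f := x) (t := Finset.univ) (by simp)]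
    simp only [count, Finset.filter_filter]
  rw [Fin.card_filter_val_lt, min_eq_right hs] at h
  exact_mod_cast h

/-- Concavity of `log` passes from the averaged estimator to the average of the divergences.
Positivity of every biased count keeps the divergence finite, and `1/s ≤ 1/m`. -/
lemma kl_pOTB_le (hp : p ∈ stdSimplex ℝ (Fin K)) {m : ℕ} (hm : 0 < m) (hn : n = 2 * m)
    (x : Fin n → Fin K)
    (hpos : ∀ s ∈ Finset.Ico m (2 * m), ∀ i, 0 < (count x s i : ℝ) + gam c δ x i) :
    kl p (pOTB c δ x) ≤ ((1 / (m : ℝ) * (1 / (m : ℝ) * ∑ s ∈ Finset.Ico m (2 * m),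
      ∑ i, relEnt (s * p i) (count x s i + gam c δ x i)) : ℝ) : EReal) := by
  classical
  have hm' : (0 : ℝ) < m := by exact_mod_cast hm
  set G := ∑ j, gam c δ x j with hG
  have hG0 : 0 ≤ G := Finset.sum_nonneg fun i _ => gam_nonneg c δ x i
  set q : ℕ → Fin K → ℝ := fun s i => ((count x s i : ℝ) + gam c δ x i) / ((s : ℝ) + G) with hq
  have hsm : ∀ s ∈ Finset.Ico m (2 * m), (m : ℝ) ≤ s := fun s hs => by
    exact_mod_cast (Finset.mem_Ico.1 hs).1
  have hqpos : ∀ s ∈ Finset.Ico m (2 * m), ∀ i, 0 < q s i := fun s hs i =>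
    div_pos (hpos s hs i) (by linarith [hsm s hs])
  have hO : ∀ i, pOTB c δ x i = ∑ s ∈ Finset.Ico m (2 * m), (1 / (m : ℝ)) * q s i :=
    fun i => pOTB_eq hn c δ x i
  have hne : (Finset.Ico m (2 * m)).Nonempty := ⟨m, by simp; omega⟩
  have hOpos : ∀ i, 0 < pOTB c δ x i := fun i => by
    rw [hO]
    exact Finset.sum_pos (fun s hs => mul_pos (by positivity) (hqpos s hs i)) hne
  unfold kl
  rw [if_neg (by rintro ⟨i, _, h⟩; exact (hOpos i).ne' h), EReal.coe_le_coe_iff]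
  have hjen : ∀ i, ∑ s ∈ Finset.Ico m (2 * m), (1 / (m : ℝ)) * Real.log (q s i) ≤
      Real.log (pOTB c δ x i) := by
    intro i
    rw [hO]
    have := strictConcaveOn_log_Ioi.concaveOn.le_map_sum (t := Finset.Ico m (2 * m))
      (w := fun _ => 1 / (m : ℝ)) (p := fun s => q s i) (fun _ _ => by positivity)
      (by
        simp only [Finset.sum_const, Nat.card_Ico, nsmul_eq_mul]
        rw [show 2 * m - m = m by omega]
        field_simp)
      (fun s hs => hqpos s hs i)
    simpa only [smul_eq_mul] using this
  have hone : ∑ s ∈ Finset.Ico m (2 * m), (1 / (m : ℝ)) = 1 := by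
    simp only [Finset.sum_const, Nat.card_Ico, nsmul_eq_mul]
    rw [show 2 * m - m = m by omega]
    field_simp
  have hterm : ∀ i, p i * Real.log (p i / pOTB c δ x i) ≤
      ∑ s ∈ Finset.Ico m (2 * m), (1 / (m : ℝ)) * (p i * Real.log (p i / q s i)) := by
    intro i
    rcases (hp.1 i).eq_or_lt with h | h
    · simp [← h]
    · have e : ∀ s ∈ Finset.Ico m (2 * m), (1 / (m : ℝ)) * (p i * Real.log (p i / q s i)) =
          (1 / (m : ℝ)) * (p i * Real.log (p i)) - p i * ((1 / (m : ℝ)) * Real.log (q s i)) := by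
        intro s hs
        rw [Real.log_div h.ne' (hqpos s hs i).ne']
        ring
      rw [Finset.sum_congr rfl e, Finset.sum_sub_distrib, ← Finset.sum_mul, ← Finset.mul_sum,
        hone, Real.log_div h.ne' (hOpos i).ne']
      have := mul_le_mul_of_nonneg_left (hjen i) h.le
      linarith
  calc ∑ i, p i * Real.log (p i / pOTB c δ x i)
      ≤ ∑ i, ∑ s ∈ Finset.Ico m (2 * m), (1 / (m : ℝ)) * (p i * Real.log (p i / q s i)) :=
        Finset.sum_le_sum fun i _ => hterm i
    _ = ∑ s ∈ Finset.Ico m (2 * m), (1 / (m : ℝ)) * ∑ i, p i * Real.log (p i / q s i) := by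
        rw [Finset.sum_comm]
        simp only [Finset.mul_sum]
    _ ≤ ∑ s ∈ Finset.Ico m (2 * m), (1 / (m : ℝ)) * (1 / (m : ℝ) *
          ∑ i, relEnt (s * p i) (count x s i + gam c δ x i)) := by
        refine Finset.sum_le_sum fun s hs => mul_le_mul_of_nonneg_left ?_ (by positivity)
        have hs0 : (0 : ℝ) < s := hm'.trans_le (hsm s hs)
        have hsn : s ≤ n := by
          have := (Finset.mem_Ico.1 hs).2
          omega
        refine (sum_mul_log_div_le hp hs0 (sum_count x hsn) (gam_nonneg c δ x)
          (hpos s hs)).trans ?_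
        refine mul_le_mul_of_nonneg_right (one_div_le_one_div_of_le hm' (hsm s hs)) ?_
        exact Finset.sum_nonneg fun i _ =>
          relEnt_nonneg (mul_nonneg hs0.le (hp.1 i)) (hpos s hs i)
    _ = _ := by simp only [← Finset.mul_sum]

/-- At most `J` categories are biased, so the parts `log (K/δ) / J` total at most `log (K/δ) ≤ K +
log (1/δ)`; the parts `1` total at most `K`. -/
lemma sum_gam_le (hK : 0 < K) (hδ : 0 < δ) (hδ1 : δ < 1) (x : Fin n → Fin K) :
    ∑ i, gam c δ x i ≤ 2 * K + Real.log (1 / δ) := by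
  classical
  have hK' : (0 : ℝ) < K := by exact_mod_cast hK
  have hK1 : (1 : ℝ) ≤ K := by exact_mod_cast hK
  have hl : Real.log (K / δ) = Real.log K + Real.log (1 / δ) := by
    rw [← Real.log_mul hK'.ne' (by positivity)]
    congr 1
    ring
  have hL : 0 ≤ Real.log (1 / δ) := Real.log_nonneg ((one_le_div hδ).2 hδ1.le)
  have hlK : Real.log K ≤ K := (Real.log_le_sub_one_of_pos hK').trans (by linarith)
  have hl0 : 0 ≤ Real.log (K / δ) := by rw [hl]; linarith [Real.log_nonneg hK1]
  have h1 : ∑ i, gam c δ x i = (rare c δ x).card * max 1 (Real.log (K / δ) / J c δ x) := by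
    unfold gam
    rw [Finset.sum_ite_mem, Finset.univ_inter, Finset.sum_const, nsmul_eq_mul]
  have hJ : ((rare c δ x).card : ℝ) ≤ J c δ x := by
    exact_mod_cast le_max_right _ _
  have hJ0 : (0 : ℝ) < J c δ x := by
    have : 3 ≤ J c δ x := le_max_left _ _
    exact_mod_cast (by omega : 0 < J c δ x)
  have hcard : ((rare c δ x).card : ℝ) ≤ K := by
    have := Finset.card_le_univ (rare c δ x)
    rw [Fintype.card_fin] at this
    exact_mod_cast this
  have h2 : max 1 (Real.log (K / δ) / J c δ x) ≤ 1 + Real.log (K / δ) / J c δ x :=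
    max_le (by linarith [div_nonneg hl0 hJ0.le]) (by linarith)
  have h3 : ((rare c δ x).card : ℝ) * (Real.log (K / δ) / J c δ x) ≤ Real.log (K / δ) := by
    rw [mul_div_assoc', div_le_iff₀ hJ0, mul_comm]
    exact mul_le_mul_of_nonneg_left hJ hl0
  have h4 := mul_le_mul_of_nonneg_left h2 (Nat.cast_nonneg (α := ℝ) (rare c δ x).card)
  rw [h1]
  linarith

/-! ### Light categories, typical samples and the bound at one category -/

open Classical in
/-- The categories of small probability. -/
noncomputable def light (n : ℕ) (δ : ℝ) (p : Fin K → ℝ) : Finset (Fin K) :=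
  Finset.univ.filter fun i : Fin K => (n : ℝ) * p i < 32 * Real.log (K / δ)

lemma Jtilde_eq (n : ℕ) (δ : ℝ) (p : Fin K → ℝ) : Jtilde n δ p = max 3 (light n δ p).card := rfl

/-- The logarithmic factor `max 1 (log (J̃ / log (1 / δ)))`. -/
noncomputable def logFactor (n : ℕ) (δ : ℝ) (p : Fin K → ℝ) : ℝ :=
  max 1 (Real.log (Jtilde n δ p / Real.log (1 / δ)))

open Classical in
/-- The cost of a category with mean `μ` that is seen far less often than expected. -/
noncomputable def missCost (T μ : ℝ) (N : ℕ) : ℝ := if (N : ℝ) < μ / T ∧ T < μ then μ else 0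

/-- A typical sample. -/
structure Typical (m : ℕ) (δ : ℝ) (p : Fin K → ℝ) (x : Fin n → Fin K) : Prop where
  supp : ∀ t, p (x t) ≠ 0
  heavy_count : ∀ i ∉ light n δ p, m * p i / 2 ≤ count x m i
  light_count : ∀ i ∈ light n δ p, (count x m i : ℝ) < 32 * Real.log (K / δ)
  heavy_sum : ∑ s ∈ Finset.Ico m (2 * m), ∑ i,
    (if i ∈ light n δ p then 0 else relEnt (count x s i) (s * p i)) ≤
      m * (2 * ∑ i, (if i ∈ light n δ p then 0 else 2) + 2 * Real.log (1 / δ))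
  light_sum : ∑ s ∈ Finset.Ico m (2 * m), ∑ i,
    (if i ∈ light n δ p then relEnt (count x s i) (s * p i) else 0) ≤
      m * (2 * ∑ i, (if i ∈ light n δ p then 2 else 0) + 2 * Real.log (1 / δ))
  -- The first `2 * log (1/δ)` bounds the exponential moments summed over light categories; the
  -- second is the deviation term.
  miss_sum : ∑ s ∈ Finset.Ico m (2 * m), ∑ i,
    (if i ∈ light n δ p then missCost (24 * logFactor n δ p) (s * p i) (count x s i) else 0) ≤
      m * (2 * Real.log (1 / δ) + 2 * Real.log (1 / δ))

lemma count_mono (x : Fin n → Fin K) {s t : ℕ} (h : s ≤ t) (i : Fin K) :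
    count x s i ≤ count x t i := by
  unfold count
  refine Finset.card_le_card fun r hr => ?_
  simp only [Finset.mem_filter, Finset.mem_univ, true_and] at hr ⊢
  exact ⟨by omega, hr.2⟩

lemma count_eq_zero {x : Fin n → Fin K} (hx : ∀ t, p (x t) ≠ 0) {i : Fin K} (hi : p i = 0)
    (s : ℕ) : count x s i = 0 := by
  unfold count
  rw [Finset.card_eq_zero, Finset.filter_eq_empty_iff]
  rintro t _ ⟨_, rfl⟩
  exact hx t hi

/-- Since `c ≥ 1`, the threshold defining `rare` is at least the level that light counts stay below.
-/
lemma Jtilde_le_J {m : ℕ} (hn : n = 2 * m) (hK : 0 < K) (hδ : 0 < δ) (hc : 1 ≤ c)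
    {x : Fin n → Fin K} (hx : Typical m δ p x) :
    light n δ p ⊆ rare c δ x ∧ Jtilde n δ p ≤ J c δ x := by
  classical
  have hK' : (0 : ℝ) < K := by exact_mod_cast hK
  have hsub : light n δ p ⊆ rare c δ x := by
    intro i hi
    have h := hx.light_count i hi
    have e1 : n / 2 = m := by omega
    simp only [rare, Finset.mem_filter, Finset.mem_univ, true_and, e1]
    refine h.trans_le ?_
    have : Real.log (K / δ) ≤ Real.log (c * K / δ) := by
      apply Real.log_le_log (by positivity)
      gcongr
      nlinarith
    linarith
  refine ⟨hsub, ?_⟩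
  rw [Jtilde_eq]
  exact max_le_max le_rfl (Finset.card_le_card hsub)

lemma one_le_logFactor : 1 ≤ logFactor n δ p := le_max_left _ _

/-- The bound at a single category and time. -/
lemma relEnt_count_le (hp : p ∈ stdSimplex ℝ (Fin K)) {m : ℕ} (hm : 0 < m) (hn : n = 2 * m)
    (hK : 0 < K) (hδ : 0 < δ) (hδ1 : δ < 1) (hc : 1 ≤ c) {x : Fin n → Fin K}
    (hx : Typical m δ p x) {s : ℕ} (hs : s ∈ Finset.Ico m (2 * m)) (i : Fin K) :
    0 < (count x s i : ℝ) + gam c δ x i ∧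
    relEnt (s * p i) (count x s i + gam c δ x i) ≤
      (1 + Real.log 4) * (if i ∈ light n δ p then 0 else relEnt (count x s i) (s * p i)) +
      (1 + Real.log (24 * logFactor n δ p)) *
        (if i ∈ light n δ p then relEnt (count x s i) (s * p i) else 0) +
      Real.log (32 * J c δ x) * (if i ∈ light n δ p then
        missCost (24 * logFactor n δ p) (s * p i) (count x s i) else 0) + gam c δ x i := by
  classical
  have hm' : (0 : ℝ) < m := by exact_mod_cast hm
  have hK1 : (1 : ℝ) ≤ K := by exact_mod_cast hK
  obtain ⟨hms, hsm⟩ := Finset.mem_Ico.1 hs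
  have hms' : (m : ℝ) ≤ s := by exact_mod_cast hms
  have hsm' : (s : ℝ) ≤ 2 * m := by exact_mod_cast hsm.le
  have hn' : (n : ℝ) = 2 * m := by rw [hn]; push_cast; ring
  have hs0 : (0 : ℝ) < s := hm'.trans_le hms'
  have hl : 0 < Real.log (K / δ) := Real.log_pos ((one_lt_div hδ).2 (by linarith))
  have hg := gam_nonneg c δ x i
  have hN0 : (0 : ℝ) ≤ count x s i := Nat.cast_nonneg _
  by_cases hi : i ∈ light n δ p
  · have hir := (Jtilde_le_J hn hK hδ hc hx).1 hi
    have hge : gam c δ x i = max 1 (Real.log (K / δ) / J c δ x) := by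
      unfold gam
      rw [if_pos hir]
    have hg1 : 1 ≤ gam c δ x i := hge ▸ le_max_left _ _
    have hg2 : Real.log (K / δ) / J c δ x ≤ gam c δ x i := hge ▸ le_max_right _ _
    have hJ0 : (3 : ℝ) ≤ J c δ x := by
      have : 3 ≤ J c δ x := le_max_left _ _
      exact_mod_cast this
    have hy : 0 < (count x s i : ℝ) + gam c δ x i := by linarith
    refine ⟨hy, ?_⟩
    simp only [hi, if_true, mul_zero, zero_add]
    have hM := one_le_logFactor (n := n) (δ := δ) (p := p)
    set T := 24 * logFactor n δ p with hT
    have hT24 : 24 ≤ T := by linarith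
    have hlT : 0 ≤ Real.log T := Real.log_nonneg (by linarith)
    have hlJ : 0 ≤ Real.log (32 * J c δ x) := Real.log_nonneg (by linarith)
    rcases (hp.1 i).eq_or_lt with h0 | h0
    · have hz := count_eq_zero hx.supp h0.symm s
      rw [hz, ← h0]
      simp [relEnt, missCost]
    have hb : 0 < s * p i := by positivity
    have hE := relEnt_nonneg hN0 hb
    have hmiss : 0 ≤ missCost T (s * p i) (count x s i) := by
      unfold missCost
      split_ifs <;> linarith
    by_cases hcase : Real.log (s * p i / (count x s i + gam c δ x i)) ≤ Real.log T
    · have := relEnt_add_le hb hN0 hg hy hlT hcase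
      have h2 := mul_nonneg hlJ hmiss
      linarith
    -- As `γ_i ≥ 1`, a ratio above `T` forces both `N < b / T` and `T < b`: exactly the event
    -- charged by `missCost`.
    · have hlt : T < s * p i / (count x s i + gam c δ x i) := by
        by_contra hcon
        exact hcase (Real.log_le_log (by positivity) (not_lt.1 hcon))
      rw [lt_div_iff₀ hy] at hlt
      have hTpos : 0 < T := by linarith
      have hc1 : (count x s i : ℝ) < s * p i / T := by
        rw [lt_div_iff₀ hTpos]
        nlinarith
      have hc2 : T < s * p i := by nlinarith
      have hme : missCost T (s * p i) (count x s i) = s * p i := by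
        unfold missCost
        rw [if_pos ⟨hc1, hc2⟩]
      -- Lightness gives `b ≤ n p_i < 32 log (K/δ) ≤ 32 J γ_i`; here the size of the bias matters.
      have hlog : Real.log (s * p i / (count x s i + gam c δ x i)) ≤ Real.log (32 * J c δ x) := by
        apply Real.log_le_log (by positivity)
        rw [div_le_iff₀ hy]
        have hlight : (n : ℝ) * p i < 32 * Real.log (K / δ) := by
          simpa [light] using hi
        rw [hn'] at hlight
        have h1 : (s : ℝ) * p i ≤ 2 * m * p i := by gcongr
        have h2 : Real.log (K / δ) ≤ J c δ x * gam c δ x i := by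
          rw [div_le_iff₀ (by linarith)] at hg2
          linarith
        nlinarith
      have h3 : relEnt (s * p i) (count x s i + gam c δ x i) ≤
          Real.log (32 * J c δ x) * (s * p i) := by
        unfold relEnt
        have := mul_le_mul_of_nonneg_left hlog hb.le
        nlinarith
      rw [hme]
      have h4 : 0 ≤ (1 + Real.log T) * relEnt (count x s i) (s * p i) :=
        mul_nonneg (by linarith) hE
      linarith
  · simp only [hi, if_false, mul_zero, add_zero]
    have hheavy : 32 * Real.log (K / δ) ≤ (n : ℝ) * p i := by
      simpa [light] using hi
    have hnp : 0 < (n : ℝ) * p i := by linarith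
    have hpi : 0 < p i := by
      by_contra hcon
      rw [hn'] at hnp
      nlinarith [hp.1 i]
    have hb : 0 < s * p i := by positivity
    -- Since `s ≤ 2m`, half the expected count at time `m` is at least a quarter of that at time
    -- `s`; hence `log 4`, even when `γ_i = 0`.
    have h1 := hx.heavy_count i hi
    have h2 : (count x m i : ℝ) ≤ count x s i := by exact_mod_cast count_mono x hms i
    have h3 : s * p i / 4 ≤ count x s i := by nlinarith
    have hy : 0 < (count x s i : ℝ) + gam c δ x i := by linarith
    refine ⟨hy, ?_⟩
    refine relEnt_add_le hb hN0 hg hy (Real.log_nonneg (by norm_num)) ?_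
    apply Real.log_le_log (by positivity)
    rw [div_le_iff₀ hy]
    linarith

/-! ### Probability of a typical sample -/

lemma prob_mono (hp : p ∈ stdSimplex ℝ (Fin K)) {A B : (Fin n → Fin K) → Prop}
    (h : ∀ x, A x → B x) : prob p A ≤ prob p B := by
  classical
  refine prob_le_sum hp (fun x => by split_ifs <;> norm_num) fun x hx => ?_
  rw [if_pos (h x hx)]

/-- On a miss `3N ≤ μ/8`, so `exp (μ/2) ≤ exp (5μ/8) exp (-3N)`. As `exp (-3) ≤ 1/8`, the Poisson
mean of the right side is at most `exp (-μ/4) ≤ exp (-M)`; then `1 + exp (-M) ≤ exp (exp (-M))`. -/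
lemma PoissonDominated.exp_half_missCost {s : ℕ} {μ M : ℝ} (hM : 1 ≤ M) :
    PoissonDominated s μ (fun N => Real.exp (1 / 2 * missCost (24 * M) μ N))
      (Real.exp (Real.exp (-M))) := by
  by_cases hμ : 24 * M < μ
  · have hμ0 : 0 < μ := by linarith
    have h := (one (s := s) (μ := μ)).add (pow (s := s) (μ := μ)
      (a := Real.exp (μ / 2 + μ / 8)) (x := Real.exp (-3)) (Real.exp_pos _).le (Real.exp_pos _).le)
    refine h.mono (fun N _ => ?_) ?_
    · unfold missCost
      split_ifs with hN
      · have h1 : (N : ℝ) ≤ μ / 24 := by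
          refine hN.1.le.trans ?_
          gcongr
          linarith
        have h2 : Real.exp (1 / 2 * μ) ≤ Real.exp (μ / 2 + μ / 8) * Real.exp (-3) ^ N := by
          rw [← Real.exp_nat_mul, ← Real.exp_add]
          apply Real.exp_le_exp.2
          linarith
        linarith
      · have : 0 < Real.exp (μ / 2 + μ / 8) * Real.exp (-3) ^ N := by positivity
        simp only [mul_zero, Real.exp_zero]
        linarith
    · rw [← Real.exp_add]
      have h8 : Real.exp (-3) ≤ 1 / 8 := by
        rw [Real.exp_neg, one_div]
        apply inv_anti₀ (by norm_num)
        have h3 : Real.exp 3 = Real.exp 1 ^ 3 := by rw [← Real.exp_nat_mul]; norm_num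
        rw [h3]
        have := pow_le_pow_left₀ (by norm_num) (show (2 : ℝ) ≤ Real.exp 1 by
          linarith [Real.exp_one_gt_d9]) 3
        linarith
      have h9 : Real.exp (μ / 2 + μ / 8 + μ * (Real.exp (-3) - 1)) ≤ Real.exp (-M) := by
        apply Real.exp_le_exp.2
        nlinarith
      linarith [Real.add_one_le_exp (Real.exp (-M))]
  · refine one.mono (fun N _ => ?_) (Real.one_le_exp (Real.exp_pos _).le)
    simp [missCost, hμ]

lemma div_eq_exp_neg_log (hK : 0 < K) (hδ : 0 < δ) :
    δ / K = Real.exp (- Real.log (K / δ)) := by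
  have hK' : (0 : ℝ) < K := by exact_mod_cast hK
  rw [← Real.log_inv, inv_div, Real.exp_log (by positivity)]

lemma sum_div_card_le (hK : 0 < K) (hδ : 0 < δ) (S : Finset (Fin K)) :
    ∑ _i ∈ S, δ / K ≤ δ := by
  have hK' : (0 : ℝ) < K := by exact_mod_cast hK
  have h : (S.card : ℝ) ≤ K := by
    have := Finset.card_le_univ S
    rw [Fintype.card_fin] at this
    exact_mod_cast this
  rw [Finset.sum_const, nsmul_eq_mul, mul_div_assoc', div_le_iff₀ hK', mul_comm]
  exact mul_le_mul_of_nonneg_left h hδ.le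

/-- No category of large probability is seen less than half as often as expected. -/
lemma prob_heavy_count_le (hp : p ∈ stdSimplex ℝ (Fin K)) {m : ℕ} (hn : n = 2 * m) (hK : 0 < K)
    (hδ : 0 < δ) (hδ1 : δ < 1) :
    prob p (fun x : Fin n → Fin K => ∃ i ∈ (light n δ p)ᶜ, (count x m i : ℝ) < m * p i / 2) ≤
      δ := by
  have hK1 : (1 : ℝ) ≤ K := by exact_mod_cast hK
  have hl : 0 < Real.log (K / δ) := Real.log_pos ((one_lt_div hδ).2 (by linarith))
  have hn' : (n : ℝ) = 2 * m := by rw [hn]; push_cast; ring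
  refine (prob_exists_le hp _ _).trans ((Finset.sum_le_sum fun i hi => ?_).trans
    (sum_div_card_le hK hδ _))
  have hheavy : 32 * Real.log (K / δ) ≤ (n : ℝ) * p i := by
    simpa [light] using hi
  rw [hn'] at hheavy
  -- The exponent is `-(1 - log 2) m p_i / 2`, and `m p_i ≥ 16 log (K/δ)`.
  refine prob_count_le hp (by omega) i (B := fun N => (N : ℝ) < m * p i / 2)
    (a := Real.exp (Real.log 2 * (m * p i / 2))) (x := 1 / 2) (Real.exp_pos _).le (by norm_num)
    (fun N hN => ?_) ?_
  · have e : (1 / 2 : ℝ) = Real.exp (- Real.log 2) := by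
      rw [Real.exp_neg, Real.exp_log (by norm_num)]
      norm_num
    rw [e, ← Real.exp_nat_mul, ← Real.exp_add]
    apply Real.one_le_exp
    nlinarith [Real.log_two_gt_d9]
  · rw [← Real.exp_add, div_eq_exp_neg_log hK hδ]
    apply Real.exp_le_exp.2
    nlinarith [Real.log_two_lt_d9]

/-- Every category of small probability is seen rarely. -/
lemma prob_light_count_le (hp : p ∈ stdSimplex ℝ (Fin K)) {m : ℕ} (hn : n = 2 * m) (hK : 0 < K)
    (hδ : 0 < δ) (hδ1 : δ < 1) :
    prob p (fun x : Fin n → Fin K => ∃ i ∈ light n δ p,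
      32 * Real.log (K / δ) ≤ (count x m i : ℝ)) ≤ δ := by
  have hK1 : (1 : ℝ) ≤ K := by exact_mod_cast hK
  have hl : 0 < Real.log (K / δ) := Real.log_pos ((one_lt_div hδ).2 (by linarith))
  have hn' : (n : ℝ) = 2 * m := by rw [hn]; push_cast; ring
  refine (prob_exists_le hp _ _).trans ((Finset.sum_le_sum fun i hi => ?_).trans
    (sum_div_card_le hK hδ _))
  have hlight : (n : ℝ) * p i < 32 * Real.log (K / δ) := by
    simpa [light] using hi
  rw [hn'] at hlight
  -- The exponent is `m p_i - 32 log 2 * log (K/δ)`, and `m p_i < 16 log (K/δ)`.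
  refine prob_count_le hp (by omega) i (B := fun N => 32 * Real.log (K / δ) ≤ (N : ℝ))
    (a := Real.exp (- (Real.log 2 * (32 * Real.log (K / δ))))) (x := 2) (Real.exp_pos _).le
    (by norm_num) (fun N hN => ?_) ?_
  · have e : (2 : ℝ) ^ N = Real.exp (N * Real.log 2) := by
      rw [Real.exp_nat_mul, Real.exp_log (by norm_num)]
    rw [e, ← Real.exp_add]
    apply Real.one_le_exp
    nlinarith [Real.log_two_gt_d9]
  · rw [← Real.exp_add, div_eq_exp_neg_log hK hδ]
    apply Real.exp_le_exp.2
    nlinarith [Real.log_two_gt_d9]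

lemma prob_heavy_sum_le (hp : p ∈ stdSimplex ℝ (Fin K)) {m : ℕ} (hm : 0 < m) (hn : n = 2 * m)
    (hδ : 0 < δ) (S : Finset (Fin K)) :
    prob p (fun x : Fin n → Fin K =>
      m * (2 * ∑ i, (if i ∈ S then 0 else 2) + 2 * Real.log (1 / δ)) <
      ∑ s ∈ Finset.Ico m (2 * m), ∑ i,
        (if i ∈ S then 0 else relEnt (count x s i) (s * p i))) ≤ δ := by
  refine prob_sum_gt_le hp hm hn.ge (F := fun s i N => if i ∈ S then 0 else relEnt N (s * p i))
    (fun s _ i => ?_) hδ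
  split_ifs
  · simpa using PoissonDominated.one
  · exact PoissonDominated.exp_half_relEnt (mul_nonneg (Nat.cast_nonneg _) (hp.1 i))

lemma prob_light_sum_le (hp : p ∈ stdSimplex ℝ (Fin K)) {m : ℕ} (hm : 0 < m) (hn : n = 2 * m)
    (hδ : 0 < δ) (S : Finset (Fin K)) :
    prob p (fun x : Fin n → Fin K =>
      m * (2 * ∑ i, (if i ∈ S then 2 else 0) + 2 * Real.log (1 / δ)) <
      ∑ s ∈ Finset.Ico m (2 * m), ∑ i,
        (if i ∈ S then relEnt (count x s i) (s * p i) else 0)) ≤ δ := by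
  refine prob_sum_gt_le hp hm hn.ge (F := fun s i N => if i ∈ S then relEnt N (s * p i) else 0)
    (fun s _ i => ?_) hδ
  split_ifs
  · exact PoissonDominated.exp_half_relEnt (mul_nonneg (Nat.cast_nonneg _) (hp.1 i))
  · simpa using PoissonDominated.one

/-- This dictates the choice of `logFactor`: `exp (-logFactor) ≤ log (1/δ) / J̃`, so the moments of
all misses total at most `log (1/δ)`. -/
lemma card_mul_exp_le (hδ : 0 < δ) (hδ1 : δ < 1) :
    ((light n δ p).card : ℝ) * Real.exp (- logFactor n δ p) ≤ Real.log (1 / δ) := by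
  have hL : 0 < Real.log (1 / δ) := Real.log_pos ((one_lt_div hδ).2 hδ1)
  have hJ : (0 : ℝ) < Jtilde n δ p := by
    have : 3 ≤ Jtilde n δ p := le_max_left _ _
    exact_mod_cast (by omega : 0 < Jtilde n δ p)
  have hc : ((light n δ p).card : ℝ) ≤ Jtilde n δ p := by
    exact_mod_cast le_max_right _ _
  calc ((light n δ p).card : ℝ) * Real.exp (- logFactor n δ p)
      ≤ Jtilde n δ p * Real.exp (- Real.log (Jtilde n δ p / Real.log (1 / δ))) := by
        gcongr
        exact le_max_right _ _
    _ = Real.log (1 / δ) := by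
        rw [← Real.log_inv, inv_div, Real.exp_log (by positivity)]
        field_simp

lemma prob_miss_sum_le (hp : p ∈ stdSimplex ℝ (Fin K)) {m : ℕ} (hm : 0 < m) (hn : n = 2 * m)
    (hδ : 0 < δ) (hδ1 : δ < 1) :
    prob p (fun x : Fin n → Fin K =>
      m * (2 * Real.log (1 / δ) + 2 * Real.log (1 / δ)) <
      ∑ s ∈ Finset.Ico m (2 * m), ∑ i, (if i ∈ light n δ p then
        missCost (24 * logFactor n δ p) (s * p i) (count x s i) else 0)) ≤ δ := by
  have h := prob_sum_gt_le (n := n) hp hm hn.ge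
    (F := fun s i N => if i ∈ light n δ p then
      missCost (24 * logFactor n δ p) (s * p i) N else 0)
    (v := fun i => if i ∈ light n δ p then Real.exp (- logFactor n δ p) else 0)
    (fun s _ i => by
      split_ifs
      · exact PoissonDominated.exp_half_missCost one_le_logFactor
      · simpa using PoissonDominated.one) hδ
  refine (prob_mono hp fun x hx => ?_).trans h
  refine lt_of_le_of_lt ?_ hx
  have h2 := card_mul_exp_le (n := n) (p := p) hδ hδ1
  rw [Finset.sum_ite_mem, Finset.univ_inter, Finset.sum_const, nsmul_eq_mul]
  gcongr

/-- A union bound over five failures of probability at most `δ` each; the support condition costs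
nothing. -/
lemma prob_not_typical_le (hp : p ∈ stdSimplex ℝ (Fin K)) {m : ℕ} (hm : 0 < m) (hn : n = 2 * m)
    (hK : 0 < K) (hδ : 0 < δ) (hδ1 : δ < 1) :
    ∃ B : (Fin n → Fin K) → Prop, prob p B ≤ 5 * δ ∧
      ∀ x, ¬ B x → (∀ t, p (x t) ≠ 0) → Typical m δ p x := by
  classical
  have h1 := prob_heavy_count_le hp hn hK hδ hδ1
  have h2 := prob_light_count_le hp hn hK hδ hδ1
  have h3 := prob_heavy_sum_le hp hm hn hδ (light n δ p)
  have h4 := prob_light_sum_le hp hm hn hδ (light n δ p)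
  have h5 := prob_miss_sum_le hp hm hn hδ hδ1
  have e5 := (prob_or_le (n := n) hp _ _).trans (add_le_add h4 h5)
  have e4 := (prob_or_le (n := n) hp _ _).trans (add_le_add h3 e5)
  have e3 := (prob_or_le (n := n) hp _ _).trans (add_le_add h2 e4)
  have e2 := (prob_or_le (n := n) hp _ _).trans (add_le_add h1 e3)
  refine ⟨_, e2.trans (le_of_eq (by ring)), fun x hx hsupp => ?_⟩
  rw [not_or, not_or, not_or, not_or] at hx
  obtain ⟨g1, g2, g3, g4, g5⟩ := hx
  refine ⟨hsupp, ?_, ?_, not_lt.1 g3, not_lt.1 g4, not_lt.1 g5⟩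
  · intro i hi
    by_contra hcon
    exact g1 ⟨i, Finset.mem_compl.2 hi, not_le.1 hcon⟩
  · intro i hi
    by_contra hcon
    exact g2 ⟨i, hi, not_lt.1 hcon⟩

/-! ### The deterministic bound and its simplifications -/

/-- The deterministic bound on a typical sample. -/
lemma kl_le_of_typical (hp : p ∈ stdSimplex ℝ (Fin K)) {m : ℕ} (hm : 0 < m) (hn : n = 2 * m)
    (hK : 0 < K) (hδ : 0 < δ) (hδ1 : δ < 1) (hc : 1 ≤ c) (hL : 1 ≤ Real.log (1 / δ))
    {x : Fin n → Fin K} (hx : Typical m δ p x) :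
    kl p (pOTB c δ x) ≤ ((1 / (n : ℝ) * (128 * K + 200 * Real.log (800 * J c δ x)
      * Real.log (1 / δ) + 8 * Jtilde n δ p * Real.log (24 * logFactor n δ p)) : ℝ) : EReal) := by
  classical
  have hm' : (0 : ℝ) < m := by exact_mod_cast hm
  have hn' : (n : ℝ) = 2 * m := by rw [hn]; push_cast; ring
  refine (kl_pOTB_le hp hm hn x
    fun s hs i => (relEnt_count_le hp hm hn hK hδ hδ1 hc hx hs i).1).trans ?_
  rw [EReal.coe_le_coe_iff]
  obtain ⟨hsub, hJJ⟩ := Jtilde_le_J hn hK hδ hc hx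
  set L := Real.log (1 / δ)
  set t := Real.log (24 * logFactor n δ p) with ht
  set W := Real.log (800 * J c δ x) with hW
  set j : ℝ := ((light n δ p).card : ℝ)
  have hJ3 : (3 : ℝ) ≤ Jtilde n δ p := by
    exact_mod_cast (le_max_left _ _ : 3 ≤ Jtilde n δ p)
  have hJJ' : (Jtilde n δ p : ℝ) ≤ J c δ x := by exact_mod_cast hJJ
  have hj : j ≤ Jtilde n δ p := Nat.cast_le.2 (le_max_right _ _)
  have hj0 : 0 ≤ j := Nat.cast_nonneg _
  have hjK : j ≤ K := by
    have := Finset.card_le_univ (light n δ p)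
    rw [Fintype.card_fin] at this
    exact Nat.cast_le.2 this
  have hM := one_le_logFactor (n := n) (δ := δ) (p := p)
  have ht0 : 0 ≤ t := Real.log_nonneg (by linarith)
  -- This lets the cross term `t * L` be absorbed by `W * L`, leaving `t` only against the number of
  -- light categories.
  have htW : t ≤ W := by
    apply Real.log_le_log (by linarith)
    have : logFactor n δ p ≤ J c δ x := by
      refine max_le (by linarith) ?_
      have h1 : Jtilde n δ p / L ≤ Jtilde n δ p := div_le_self (by linarith) hL
      have h0 : (0 : ℝ) < Jtilde n δ p / L := by positivity
      linarith [Real.log_le_sub_one_of_pos h0]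
    linarith
  have h32 : Real.log (32 * J c δ x) ≤ W := Real.log_le_log (by linarith) (by linarith)
  have h320 : 0 ≤ Real.log (32 * J c δ x) := Real.log_nonneg (by linarith)
  have hW1 : 1 ≤ W := by
    rw [hW, Real.le_log_iff_exp_le (by linarith)]
    linarith [Real.exp_one_lt_d9]
  have hlog4 : Real.log 4 ≤ 1.4 := by
    have : Real.log 4 = 2 * Real.log 2 := by
      rw [show (4 : ℝ) = 2 ^ 2 by norm_num, Real.log_pow]
      norm_num
    linarith [Real.log_two_lt_d9]
  have hlog40 : 0 ≤ Real.log 4 := Real.log_nonneg (by norm_num)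
  have hG := sum_gam_le (c := c) hK hδ hδ1 x
  have hA := hx.heavy_sum
  have hB := hx.light_sum
  have hC := hx.miss_sum
  have eA : ∑ i, (if i ∈ light n δ p then (0 : ℝ) else 2) = 2 * (K - j) := by
    have e : ∀ i, (if i ∈ light n δ p then (0 : ℝ) else 2)
        = 2 - (if i ∈ light n δ p then 2 else 0) := by
      intro i
      split_ifs <;> norm_num
    simp only [e, Finset.sum_sub_distrib, Finset.sum_ite_mem, Finset.univ_inter, Finset.sum_const,
      nsmul_eq_mul, Finset.card_univ, Fintype.card_fin]
    ring
  have eB : ∑ i, (if i ∈ light n δ p then (2 : ℝ) else 0) = 2 * j := by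
    rw [Finset.sum_ite_mem, Finset.univ_inter, Finset.sum_const, nsmul_eq_mul, mul_comm]
  rw [eA] at hA
  rw [eB] at hB
  have htot : ∑ s ∈ Finset.Ico m (2 * m), ∑ i, relEnt (s * p i) (count x s i + gam c δ x i) ≤
      (1 + Real.log 4) * (m * (2 * (2 * (K - j)) + 2 * L)) +
      (1 + t) * (m * (2 * (2 * j) + 2 * L)) + Real.log (32 * J c δ x) * (m * (2 * L + 2 * L))
      + m * (2 * K + L) := by
    calc _ ≤ ∑ s ∈ Finset.Ico m (2 * m), ∑ i, _ := Finset.sum_le_sum fun s hs =>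
          Finset.sum_le_sum fun i _ => (relEnt_count_le hp hm hn hK hδ hδ1 hc hx hs i).2
      _ ≤ _ := by
        simp only [Finset.sum_add_distrib, ← Finset.mul_sum]
        have hsum : ∑ _s ∈ Finset.Ico m (2 * m), ∑ i, gam c δ x i ≤ m * (2 * K + L) := by
          rw [Finset.sum_const, Nat.card_Ico, nsmul_eq_mul, show 2 * m - m = m by omega]
          exact mul_le_mul_of_nonneg_left hG hm'.le
        have h1 := mul_le_mul_of_nonneg_left hA (by linarith : 0 ≤ 1 + Real.log 4)
        have h2 := mul_le_mul_of_nonneg_left hB (by linarith : 0 ≤ 1 + t)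
        have h3 := mul_le_mul_of_nonneg_left hC h320
        exact add_le_add (add_le_add (add_le_add h1 h2) h3) hsum
  -- The factor `2` converts `1/m` to `1/n`. The term `8 J̃ t` comes from `2 * t * 4j`; the
  -- remaining terms in `K` and `j` fit into `128 K`, those in `L` into `200 W L`.
  have hfin : 2 * ((1 + Real.log 4) * (2 * (2 * (K - j)) + 2 * L) +
      (1 + t) * (2 * (2 * j) + 2 * L) + Real.log (32 * J c δ x) * (2 * L + 2 * L)
      + (2 * K + L)) ≤ 128 * K + 200 * W * L + 8 * Jtilde n δ p * t := by
    have a1 := mul_le_mul_of_nonneg_right hlog4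
      (by linarith : 0 ≤ 2 * (2 * (K - j)) + 2 * L)
    have a2 := mul_le_mul_of_nonneg_right htW (by linarith : 0 ≤ L)
    have a3 := mul_le_mul_of_nonneg_right h32 (by linarith : 0 ≤ L)
    have a4 := mul_le_mul_of_nonneg_right hW1 (by linarith : 0 ≤ L)
    have a5 := mul_le_mul_of_nonneg_right hj ht0
    linarith
  have hmain : 1 / (m : ℝ) * ∑ s ∈ Finset.Ico m (2 * m),
      ∑ i, relEnt (s * p i) (count x s i + gam c δ x i) ≤
      1 / 2 * (128 * K + 200 * W * L + 8 * Jtilde n δ p * t) := by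
    rw [one_div_mul_eq_div, div_le_iff₀ hm']
    have := mul_le_mul_of_nonneg_left hfin hm'.le
    linarith
  calc _ ≤ 1 / (m : ℝ) * (1 / 2 * (128 * K + 200 * W * L + 8 * Jtilde n δ p * t)) :=
        mul_le_mul_of_nonneg_left hmain (by positivity)
    _ = _ := by
        rw [hn']
        field_simp

/-- Here `k, a, b, L` stand for `K, J̃, J, log (1/δ)`. The constant from `log 24` costs a multiple
of `a ≤ 3k`, and `log 800 ≤ 7 log 3 ≤ 7 log b`. -/
lemma bound_le {k a b L : ℝ} (ha : 3 ≤ a) (hak : a ≤ 3 * k) (hb : 3 ≤ b) (hL : 1 ≤ L) :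
    128 * k + 200 * Real.log (800 * b) * L + 8 * a * Real.log (24 * max 1 (Real.log (a / L))) ≤
      1600 * (k + a * Real.log (Real.log a) + Real.log b * L) := by
  have h3 := Real.log_three_gt_d9
  have hla : Real.log 3 ≤ Real.log a := Real.log_le_log (by norm_num) ha
  have hlb : Real.log 3 ≤ Real.log b := Real.log_le_log (by norm_num) hb
  have hlla : 0 ≤ Real.log (Real.log a) := Real.log_nonneg (by linarith)
  have h1 : Real.log (800 * b) ≤ 8 * Real.log b := by
    rw [Real.log_mul (by norm_num) (by linarith)]
    have : Real.log 800 ≤ 7 * Real.log 3 := by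
      rw [← Real.log_rpow (by norm_num)]
      apply Real.log_le_log (by norm_num)
      norm_num
    linarith
  have h2 : max 1 (Real.log (a / L)) ≤ Real.log a := by
    refine max_le (by linarith) (Real.log_le_log (by positivity) (div_le_self (by linarith) hL))
  have h4 : Real.log (24 * max 1 (Real.log (a / L))) ≤ 4 + Real.log (Real.log a) := by
    have e : Real.log 24 ≤ 4 := by
      have h24 : Real.log 24 = 3 * Real.log 2 + Real.log 3 := by
        rw [show (24 : ℝ) = 2 ^ 3 * 3 by norm_num, Real.log_mul (by norm_num) (by norm_num),
          Real.log_pow]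
        norm_num
      linarith [Real.log_two_lt_d9, Real.log_three_lt_d9]
    calc _ ≤ Real.log (24 * Real.log a) :=
          Real.log_le_log (by positivity) (by linarith)
      _ = Real.log 24 + Real.log (Real.log a) :=
          Real.log_mul (by norm_num) (by linarith)
      _ ≤ _ := by linarith
  have h5 := mul_le_mul_of_nonneg_right h1 (by linarith : 0 ≤ L)
  have h6 := mul_le_mul_of_nonneg_left h4 (by linarith : 0 ≤ a)
  have h7 : 0 ≤ a * Real.log (Real.log a) := mul_nonneg (by linarith) hlla
  linarith

lemma worst_bound_le {k a b d L : ℝ} (ha : 3 ≤ a) (hb : 3 ≤ b) (hkd : k ≤ d) (had : a ≤ d)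
    (hbd : b ≤ d) (hL : 1 ≤ L) :
    k + a * Real.log (Real.log a) + Real.log b * L ≤
      14 * (d * Real.log (Real.log d) + Real.log d * L) := by
  have h3 := Real.log_three_gt_d9
  have hla : Real.log 3 ≤ Real.log a := Real.log_le_log (by norm_num) ha
  have hlb : Real.log 3 ≤ Real.log b := Real.log_le_log (by norm_num) hb
  have hbd' : Real.log b ≤ Real.log d := Real.log_le_log (by linarith) hbd
  have had' : Real.log a ≤ Real.log d := Real.log_le_log (by linarith) had
  have hlla : 0 ≤ Real.log (Real.log a) := Real.log_nonneg (by linarith)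
  have hll : Real.log (Real.log a) ≤ Real.log (Real.log d) :=
    Real.log_le_log (by linarith) had'
  -- From `log 3 > 13/12`. Thus `k ≤ d ≤ 13 d log log d`, which explains `14 = 13 + 1`.
  have h08 : 1 / 13 ≤ Real.log (Real.log d) := by
    have h1 := Real.one_sub_inv_le_log_of_pos (show 0 < Real.log d by linarith)
    have h2 : (Real.log d)⁻¹ ≤ 12 / 13 := by
      rw [inv_le_comm₀ (by linarith) (by norm_num)]
      norm_num
      linarith
    linarith
  have h5 : a * Real.log (Real.log a) ≤ d * Real.log (Real.log d) := by gcongr; linarith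
  have h6 := mul_le_mul_of_nonneg_left h08 (by linarith : 0 ≤ d)
  have h7 := mul_le_mul_of_nonneg_right hbd' (by linarith : 0 ≤ L)
  have h8 : 0 ≤ Real.log d * L := mul_nonneg (by linarith) (by linarith)
  linarith

lemma Jtilde_le (n : ℕ) (δ : ℝ) (p : Fin K → ℝ) : Jtilde n δ p ≤ max 3 K :=
  max_le_max le_rfl ((Finset.card_le_univ _).trans (by simp))

lemma J_le (c δ : ℝ) (x : Fin n → Fin K) : J c δ x ≤ max 3 K :=
  max_le_max le_rfl ((Finset.card_le_univ _).trans (by simp))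

end

end OTB

/-! ### The main theorem -/

theorem mainTheorem3 :
    ∃ C : ℝ, 0 < C ∧
      ∀ (K n : ℕ) (p : Fin K → ℝ) (δ c : ℝ),
        p ∈ stdSimplex ℝ (Fin K) → 0 < δ → δ < 1 → 1 ≤ c → c ≤ 4 →
        Even n → Real.log (K / δ) ≤ n → K ≤ n →
      ∀ (Ω : Type*) [MeasurableSpace Ω] (P : Measure Ω) [IsProbabilityMeasure P]
        (X : Fin n → Ω → Fin K),
        (∀ t, Measurable (X t)) → iIndepFun X P → (∀ t i, P.real {ω | X t ω = i} = p i) →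
        1 - 5 * δ ≤ P.real {ω | OTB.kl p (OTB.pOTB c δ fun t => X t ω) ≤
          ((1 / (n : ℝ) * (128 * K
            + 200 * Real.log (800 * OTB.J c δ fun t => X t ω) * Real.log (1 / δ)
            + 8 * OTB.Jtilde n δ p * Real.log
                (24 * max 1 (Real.log (OTB.Jtilde n δ p / Real.log (1 / δ))))) : ℝ) : EReal)} ∧
        1 - 5 * δ ≤ P.real {ω | OTB.kl p (OTB.pOTB c δ fun t => X t ω) ≤
          ((C * ((K + OTB.Jtilde n δ p * Real.log (Real.log (OTB.Jtilde n δ p))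
            + Real.log (OTB.J c δ fun t => X t ω) * Real.log (1 / δ)) / n) : ℝ) : EReal)} ∧
        1 - 5 * δ ≤ P.real {ω | OTB.kl p (OTB.pOTB c δ fun t => X t ω) ≤
          ((C * (((max 3 K : ℕ) * Real.log (Real.log (max 3 K : ℕ))
            + Real.log (max 3 K : ℕ) * Real.log (1 / δ)) / n) : ℝ) : EReal)} := by
  refine ⟨1600 * 14, by norm_num, ?_⟩
  intro K n p δ c hp hδ hδ1 hc _ hn _ hKn Ω _ P _ X _ hind hX
  -- For `δ ≥ 1/5` the probability bounds are vacuous; otherwise `1/δ > 5 > e` gives `log (1/δ) ≥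
  -- 1`.
  by_cases h5 : 1 / 5 ≤ δ
  · have h0 : 1 - 5 * δ ≤ 0 := by linarith
    exact ⟨h0.trans measureReal_nonneg, h0.trans measureReal_nonneg, h0.trans measureReal_nonneg⟩
  have hK : 0 < K := by
    rcases Nat.eq_zero_or_pos K with rfl | h
    · have := hp.2
      simp at this
    · exact h
  obtain ⟨m, hm2⟩ := hn
  have hn2 : n = 2 * m := by omega
  have hm : 0 < m := by omega
  have hn0 : (0 : ℝ) < n := by exact_mod_cast (by omega : 0 < n)
  have hL : 1 ≤ Real.log (1 / δ) := by
    rw [Real.le_log_iff_exp_le (by positivity), le_div_iff₀ hδ]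
    nlinarith [Real.exp_one_lt_d9, Real.exp_pos 1]
  obtain ⟨B, hB, hBt⟩ := OTB.prob_not_typical_le hp hm hn2 hK hδ hδ1
  have hB' : 1 - 5 * δ ≤ 1 - OTB.prob p B := by linarith
  have h1 := fun x hx hs => OTB.kl_le_of_typical hp hm hn2 hK hδ hδ1 hc hL (hBt x hx hs)
  have hK1 : (1 : ℝ) ≤ K := by exact_mod_cast hK
  have hJt : (3 : ℝ) ≤ OTB.Jtilde n δ p := by
    exact_mod_cast (le_max_left _ _ : 3 ≤ OTB.Jtilde n δ p)
  have hJtd : (OTB.Jtilde n δ p : ℝ) ≤ (max 3 K : ℕ) := by exact_mod_cast OTB.Jtilde_le n δ p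
  have hdK : ((max 3 K : ℕ) : ℝ) ≤ 3 * K := by
    exact_mod_cast (by omega : max 3 K ≤ 3 * K)
  have hKd : (K : ℝ) ≤ (max 3 K : ℕ) := by exact_mod_cast le_max_right 3 K
  have hJ : ∀ x : Fin n → Fin K, (3 : ℝ) ≤ OTB.J c δ x := fun x => by
    exact_mod_cast (le_max_left _ _ : 3 ≤ OTB.J c δ x)
  have hJd : ∀ x : Fin n → Fin K, (OTB.J c δ x : ℝ) ≤ (max 3 K : ℕ) := fun x => by
    exact_mod_cast OTB.J_le c δ x
  have h2 := fun x => OTB.bound_le hJt (hJtd.trans hdK) (hJ x) hL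
  have h3 := fun x => OTB.worst_bound_le hJt (hJ x) hKd hJtd (hJd x) hL
  have hpos : ∀ x : Fin n → Fin K, 0 ≤ (K : ℝ) + OTB.Jtilde n δ p *
      Real.log (Real.log (OTB.Jtilde n δ p)) + Real.log (OTB.J c δ x) * Real.log (1 / δ) := by
    intro x
    have hl3 : 1 ≤ Real.log (OTB.Jtilde n δ p) :=
      (by linarith [Real.log_three_gt_d9] : (1 : ℝ) ≤ Real.log 3).trans
        (Real.log_le_log (by norm_num) hJt)
    have a1 := Real.log_nonneg hl3
    have a2 := Real.log_nonneg (by linarith [hJ x] : (1 : ℝ) ≤ OTB.J c δ x)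
    positivity
  refine ⟨hB'.trans (OTB.one_sub_le_measureReal P hind hX (A := fun x => _)
      fun x hx hs => h1 x hx hs),
    hB'.trans (OTB.one_sub_le_measureReal P hind hX (A := fun x => OTB.kl p (OTB.pOTB c δ x) ≤
      ((1600 * 14 * ((K + OTB.Jtilde n δ p * Real.log (Real.log (OTB.Jtilde n δ p))
        + Real.log (OTB.J c δ x) * Real.log (1 / δ)) / n) : ℝ) : EReal)) fun x hx hs => ?_),
    hB'.trans (OTB.one_sub_le_measureReal P hind hX (A := fun x => OTB.kl p (OTB.pOTB c δ x) ≤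
      ((1600 * 14 * (((max 3 K : ℕ) * Real.log (Real.log (max 3 K : ℕ))
        + Real.log (max 3 K : ℕ) * Real.log (1 / δ)) / n) : ℝ) : EReal)) fun x hx hs => ?_)⟩
  · refine (h1 x hx hs).trans ?_
    rw [EReal.coe_le_coe_iff, one_div_mul_eq_div, mul_div_assoc']
    refine div_le_div_of_nonneg_right ((h2 x).trans ?_) hn0.le
    linarith [hpos x]
  · refine (h1 x hx hs).trans ?_
    rw [EReal.coe_le_coe_iff, one_div_mul_eq_div, mul_div_assoc']
    refine div_le_div_of_nonneg_right ((h2 x).trans ?_) hn0.le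
    linarith [h3 x]
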